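/- Let $q$ be a prime number and identify $\mathbb{F}_q$ with $\{0,1,\dots,q-1\}$. Let $\mathbb{F}_q((t^{-1}))$ be the field of formal Laurent series $g=\sum_{i\ge w} g_i t^{-i}$ ($w\in\mathbb{Z}$, $g_i\in\mathbb{F}_q$), with fractional part $\{g\}=\sum_{i\ge \max(1,w)} g_i t^{-i}$. Let $G_q$ be the compact group of all series of the form $\sum_{i\ge 1} g_i t^{-i}$, let $\phi\big(\sum_{i\ge1} g_i t^{-i}\big)=\sum_{i\ge 1} g_i q^{-i}\in\mathbb{R}$ on $G_q$, and let $\mu_d$ be the $d$-fold product of the normalized Haar measure of $G_q$. For $\boldsymbol{f}\in G_q^d$ put $\boldsymbol{x}_n=\phi(\{t^{n-1}\boldsymbol{f}\})$ for $n\ge 1$, with $\{\cdot\}$ and $\phi$ applied componentwise, and let $\mathcal{P}_N(\boldsymbol{f})=\{\boldsymbol{x}_1,\dots,\boldsymbol{x}_N\}$ (counted with multiplicity). Let $$D_N^*(\mathcal{P}_N(\boldsymbol{f}))=\sup_{\boldsymbol{t}\in[0,1]^d}\left|\frac{\#\{1\le n\le N:\boldsymbol{x}_n\in[\boldsymbol{0},\boldsymbol{t})\}}{N}-\lambda([\boldsymbol{0},\boldsymbol{t}))\right|,$$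 where $[\boldsymbol{0},\boldsymbol{t})=\prod_{j=1}^d[0,t_j)$ and $\lambda$ is Lebesgue measure. Theorem. For every prime $q$ there are positive quantities $C(q,\varepsilon)$, $\varepsilon\in(0,1)$, depending only on $q$ and $\varepsilon$, with $C(q,\varepsilon)\asymp\log\varepsilon^{-1}$ as $\varepsilon\to0^+$ (the implied constants may depend on $q$), such that for all integers $N,d\ge 2$ and every $\varepsilon\in(0,1)$ $$\mu_d\left(\left\{\boldsymbol{f}\in G_q^d:\ D_N^*(\mathcal{P}_N(\boldsymbol{f}))\le C(q,\varepsilon)\sqrt{\frac{d\log d}{N}}\right\}\right)\ge 1-\varepsilon .$$ -/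

import Mathlib

open MeasureTheory Filter Topology Asymptotics

/-! ### Laurent series in `t⁻¹` over `ℤ/qℤ`

A Laurent series `g = ∑_{i ≥ w} g_i t^{-i}` is an element of Mathlib's `LaurentSeries (ZMod q)`,
whose formal variable is read as `t⁻¹`; thus `g.coeff i` is the coefficient `g_i` of `t^{-i}`.
The topology is the one of the valuation `v(g) = min {i | g_i ≠ 0}`. -/

/-- The indeterminate `t`, i.e. the inverse of the variable `t⁻¹` of the Laurent series. -/
noncomputable def tVar (q : ℕ) : LaurentSeries (ZMod q) := HahnSeries.single (-1 : ℤ) (1 : ZMod q)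

/-- The group of the Laurent series of the form `∑_{i ≥ 1} g_i t^{-i}`. -/
def fracSubgroup (q : ℕ) : AddSubgroup (LaurentSeries (ZMod q)) where
  carrier := {g | ∀ i : ℤ, i ≤ 0 → g.coeff i = 0}
  zero_mem' := by
    intro i _
    simp
  add_mem' := by
    intro a b ha hb i hi
    simp [ha i hi, hb i hi]
  neg_mem' := by
    intro a ha i hi
    simp [ha i hi]

/-- The Laurent series of the form `∑_{i ≥ 1} g_i t^{-i}`, as a type. -/
abbrev FracSeries (q : ℕ) : Type := fracSubgroup q

/-- The fractional part `{g} = ∑_{i ≥ max(1,w)} g_i t^{-i}` of `g = ∑_{i ≥ w} g_i t^{-i}`. -/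
noncomputable def fracPart {q : ℕ} (g : LaurentSeries (ZMod q)) : FracSeries q :=
  ⟨{ coeff := fun i => if 1 ≤ i then g.coeff i else 0
     isPWO_support' := g.isPWO_support.mono (fun i hi => by
       by_cases h : 1 ≤ i <;> simp_all [Function.mem_support]) },
   fun i hi => by
     have h : ¬ (1 ≤ i) := by omega
     exact if_neg h⟩

/-- `φ (∑_{i ≥ 1} g_i t^{-i}) = ∑_{i ≥ 1} g_i q^{-i}`, the digits `g_i` being read as the integers
`0, …, q - 1`. -/
noncomputable def phi {q : ℕ} (g : FracSeries q) : ℝ :=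
  ∑' i : ℕ, (((g : LaurentSeries (ZMod q)).coeff ((i : ℤ) + 1)).val : ℝ) / (q : ℝ) ^ (i + 1)

/-- The series `∑_{i ≥ 1} c_{i-1} t^{-i}` with prescribed coefficients. -/
def ofDigits {q : ℕ} (c : ℕ → ZMod q) : FracSeries q :=
  ⟨{ coeff := fun i => if 1 ≤ i then c (i - 1).toNat else 0
     isPWO_support' := by
       refine Set.IsWF.isPWO (BddBelow.isWF ⟨1, fun i hi => ?_⟩)
       by_contra h
       exact hi (if_neg h) },
   fun i hi => by
     have h : ¬ (1 ≤ i) := by omega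
     exact if_neg h⟩

theorem ofDigits_surjective {q : ℕ} : Function.Surjective (ofDigits (q := q)) := by
  intro g
  refine ⟨fun n => (g : LaurentSeries (ZMod q)).coeff ((n : ℤ) + 1), ?_⟩
  apply Subtype.ext
  ext i
  change (if 1 ≤ i then _ else _) = _
  split_ifs with h
  · have : (((i - 1).toNat : ℤ)) + 1 = i := by omega
    rw [this]
  · exact (g.2 i (by omega)).symm

theorem ofDigits_continuous {q : ℕ} [Fact q.Prime] :
    letI : TopologicalSpace (ZMod q) := ⊥
    Continuous (ofDigits (q := q)) := by
  let _ : TopologicalSpace (ZMod q) := ⊥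
  have : DiscreteTopology (ZMod q) := ⟨rfl⟩
  rw [continuous_induced_rng, continuous_iff_continuousAt]
  intro c
  rw [ContinuousAt, Filter.tendsto_def]
  intro s hs
  obtain ⟨γ, hγ⟩ := Valued.mem_nhds.mp hs
  let e : WithZero (Multiplicative ℤ) := MonoidWithZeroHom.ValueGroup₀.embedding γ.1
  let D : ℤ := -(WithZero.log e - 1)
  have hD : WithZero.exp (-D) < e := by
    rw [← WithZero.lt_log_iff_exp_lt (by simp [e])]
    simp [D]
  have hmem : {c' : ℕ → ZMod q | ∀ k ∈ Finset.range D.toNat, c' k = c k} ∈ 𝓝 c := by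
    have hopen : IsOpen {c' : ℕ → ZMod q | ∀ k ∈ Finset.range D.toNat, c' k = c k} := by
      have : {c' : ℕ → ZMod q | ∀ k ∈ Finset.range D.toNat, c' k = c k} =
          ⋂ k ∈ Finset.range D.toNat, (fun c' : ℕ → ZMod q => c' k) ⁻¹' {c k} := by
        ext c'
        simp
      rw [this]
      exact isOpen_biInter_finset fun k _ => (isOpen_discrete _).preimage (continuous_apply k)
    exact hopen.mem_nhds (fun _ _ => rfl)
  refine Filter.mem_of_superset hmem fun c' hc' => hγ ?_
  refine Valued.v.restrict_lt_iff_lt_embedding.mpr (lt_of_le_of_lt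
    ((LaurentSeries.valuation_le_iff_coeff_lt_eq_zero (ZMod q)).mpr fun n hn => ?_) hD)
  rw [HahnSeries.coeff_sub, sub_eq_zero]
  change (if 1 ≤ n then c' (n - 1).toNat else 0) = (if 1 ≤ n then c (n - 1).toNat else 0)
  split_ifs with h
  · exact hc' _ (Finset.mem_range.mpr (by omega))
  · rfl

/-- The group of fractional parts is compact. -/
instance fracSeries_compactSpace (q : ℕ) [Fact q.Prime] : CompactSpace (FracSeries q) := by
  let _ : TopologicalSpace (ZMod q) := ⊥
  have : NeZero q := ⟨(Fact.out : q.Prime).ne_zero⟩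
  exact ofDigits_surjective.compactSpace ofDigits_continuous

noncomputable instance fracSeries_measurableSpace (q : ℕ) [Fact q.Prime] : MeasurableSpace (FracSeries q) :=
  borel _

instance fracSeries_borelSpace (q : ℕ) [Fact q.Prime] : BorelSpace (FracSeries q) := ⟨rfl⟩

/-- The Haar measure on the compact group of fractional parts, normalized to total mass `1`. -/
noncomputable def haarFrac (q : ℕ) [Fact q.Prime] : Measure (FracSeries q) :=
  Measure.addHaarMeasure ⊤

/-- The `d`-fold product of the normalized Haar measure. -/
noncomputable def haarFracPi (q d : ℕ) [Fact q.Prime] : Measure (Fin d → FracSeries q) :=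
  Measure.pi fun _ => haarFrac q

/-- The point set `P_N(f)`: the points `x_n = φ({t^{n-1} f})`, `1 ≤ n ≤ N`, where `φ` and the
fractional part act componentwise. The index `i : Fin N` stands for `n - 1`. -/
noncomputable def pointSet {q d : ℕ} (N : ℕ) (f : Fin d → FracSeries q) :
    Fin N → Fin d → ℝ :=
  fun i j => phi (fracPart (tVar q ^ (i : ℕ) * (f j : LaurentSeries (ZMod q))))

/-- The box `[0, t) = ∏_j [0, t_j)`. -/
def box {d : ℕ} (t : Fin d → ℝ) : Set (Fin d → ℝ) := Set.univ.pi fun j => Set.Ico 0 (t j)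

/-- The star discrepancy of the points `x_1, …, x_N`: the supremum over `t ∈ [0,1]^d` of
`|A([0,t)) / N - λ([0,t))|`, where `A([0,t))` is the number of indices `n` with `x_n ∈ [0,t)`. -/
noncomputable def starDiscrepancy {d N : ℕ} (x : Fin N → Fin d → ℝ) : ℝ :=
  ⨆ t : Fin d → Set.Icc (0 : ℝ) 1,
    |(Set.ncard {n : Fin N | x n ∈ box fun j => (t j : ℝ)} : ℝ) / (N : ℝ)
      - (volume : Measure (Fin d → ℝ)).real (box fun j => (t j : ℝ))|

/-!
The digits of the points `x_n = φ({t^{n-1} f})` form sliding windows: the `i`-th digit of the `j`-th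
coordinate of `x_n` is the coefficient of index `n + i - 1` of `f_j`. Under the Haar measure all
these coefficients are independent and uniform, because every finite block of them is a surjective
homomorphism to a finite group (`measure_preimage_of_surjective_hom`, `iIndepFun_windowPi`). Hence
a function of the first `m` digits of `x_n` takes independent values at indices that differ by
multiples of `m`, and its sum over `n ≤ N` obeys a Bernstein inequality in which the variance is
enlarged by the factor `m` (`measure_abs_sum_range_ge_le`).

The supremum over all boxes is treated by chaining. At level `h` the boxes are bracketed up to
volume `3 / 4 ^ h` by at most `exp (d (3 + 3 h))` boxes with corners on a `q`-adic grid
(`exists_bracketing_cover`), and `m = O(log d + h)` digits suffice to resolve this grid. An increment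
between the levels `h` and `h + 1` has variance `O(4⁻ʰ)`, so that outside an event of measure
`ε / 2 ^ (h + 1)` all these increments are `O((12 + log (1 / ε)) h 2⁻ʰ √(N d log d))`. This is summable
over `h`; only the factor `√m` contributes the `√(log d)`, because the logarithm of the size of the
cover is `O(d h)` without an additional `log d`. The chain stops when `4⁻ʰ` falls below
`√(d log d / N)`, where the bracketing error has the size of the bound
(`abs_sum_boxInd_sub_le`, `measure_lt_starDiscrepancy_le`). The constant obtained is
`C(ε) = 1155 + 96 log (1 / ε)` for every `q`.
-/

/-! ### Finite homomorphic images of an invariant probability measure -/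

section UniformImage

variable {Ω W : Type*} [AddGroup Ω] [MeasurableSpace Ω] [MeasurableAdd Ω] {μ : Measure Ω}
  [IsProbabilityMeasure μ] [μ.IsAddLeftInvariant] [AddGroup W] [Fintype W] [MeasurableSpace W]
  [DiscreteMeasurableSpace W]

/-- A homomorphism onto a finite group sends an invariant probability measure to the uniform
distribution: the fibres are translates of each other. -/
theorem measure_preimage_of_surjective_hom (π : Ω →+ W) (hπ : Measurable π)
    (hsurj : Function.Surjective π) (A : Finset W) :
    μ (π ⁻¹' A) = (A.card : ENNReal) / Fintype.card W := by
  have hfib : ∀ w : W, μ (π ⁻¹' {w}) = μ (π ⁻¹' {0}) := by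
    intro w
    obtain ⟨ω, rfl⟩ := hsurj w
    rw [← measure_preimage_add μ ω (π ⁻¹' {π ω})]
    congr 1
    ext x
    simp
  have hsum : ∀ B : Finset W, μ (π ⁻¹' B) = B.card * μ (π ⁻¹' {0}) := by
    intro B
    have h := sum_measure_preimage_singleton (μ := μ) (f := π) B
      (fun y _ => hπ (MeasurableSet.of_discrete))
    rw [← h]
    simp [hfib]
  have hone := hsum Finset.univ
  rw [Finset.coe_univ, Set.preimage_univ, measure_univ, Finset.card_univ] at hone
  rw [hsum, ENNReal.eq_inv_of_mul_eq_one_left ((mul_comm _ _).trans hone.symm), div_eq_mul_inv]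

/-- Homomorphisms onto finite groups that are jointly surjective are independent. -/
theorem iIndepFun_of_jointly_surjective {ι : Type*} (π : ι → Ω →+ W)
    (hπ : ∀ k, Measurable (π k)) (hsurj : ∀ w : ι → W, ∃ ω, ∀ k, π k ω = w k) :
    ProbabilityTheory.iIndepFun (fun k ω => π k ω) μ := by
  classical
  rw [ProbabilityTheory.iIndepFun_iff_measure_inter_preimage_eq_mul]
  intro S sets _
  let A : ι → Finset W := fun i => (sets i).toFinset
  have hA : ∀ i, ((A i : Finset W) : Set W) = sets i := fun i => by simp [A]
  let πS : Ω →+ (S → W) := AddMonoidHom.pi fun k : S => π k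
  have hπS : Measurable πS := measurable_pi_lambda _ fun k => hπ k
  have hS : Function.Surjective πS := by
    intro w
    obtain ⟨ω, hω⟩ := hsurj (fun k => if h : k ∈ S then w ⟨k, h⟩ else 0)
    refine ⟨ω, funext fun k => ?_⟩
    have := hω k
    rw [dif_pos k.2] at this
    exact this
  have hsingle : ∀ i, μ ((fun ω => π i ω) ⁻¹' sets i) = ((A i).card : ENNReal) / Fintype.card W := by
    intro i
    rw [← hA i]
    refine measure_preimage_of_surjective_hom (π i) (hπ i) (fun w => ?_) (A i)
    obtain ⟨ω, hω⟩ := hsurj fun _ => w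
    exact ⟨ω, hω i⟩
  have hjoint := measure_preimage_of_surjective_hom (μ := μ) πS hπS hS
    (Fintype.piFinset fun k : S => A k)
  have hset : (πS ⁻¹' (Fintype.piFinset fun k : S => A k : Finset (S → W))) =
      ⋂ i ∈ S, (fun ω => π i ω) ⁻¹' sets i := by
    ext ω
    simp only [Set.mem_preimage, Finset.mem_coe, Fintype.mem_piFinset, Subtype.forall, A,
      Set.mem_toFinset, Set.mem_iInter]
    rfl
  rw [← hset, hjoint, Finset.prod_congr rfl fun i _ => hsingle i, Fintype.card_piFinset,
    Fintype.card_fun, Fintype.card_coe]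
  simp only [div_eq_mul_inv]
  rw [Finset.prod_mul_distrib, Finset.prod_const, Finset.prod_coe_sort S fun i => (A i).card]
  push_cast
  rw [ENNReal.inv_pow]

end UniformImage

/-! ### Windows of digits -/

section Windows

variable {q : ℕ}

theorem coeff_ofDigits (c : ℕ → ZMod q) (i : ℕ) :
    ((ofDigits c : FracSeries q) : LaurentSeries (ZMod q)).coeff ((i : ℤ) + 1) = c i := by
  change (if (1 : ℤ) ≤ (i : ℤ) + 1 then c ((i : ℤ) + 1 - 1).toNat else 0) = c i
  rw [if_pos (by omega)]
  simp

/-- The block of the `m` digits `g_{n+1}, …, g_{n+m}` of `g`. -/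
def window (q n m : ℕ) : FracSeries q →+ (Fin m → ZMod q) where
  toFun g i := (g : LaurentSeries (ZMod q)).coeff (((n + i : ℕ) : ℤ) + 1)
  map_zero' := by
    ext i
    simp
  map_add' g h := by
    ext i
    simp

theorem window_apply (g : FracSeries q) (n m : ℕ) (i : Fin m) :
    window q n m g i = (g : LaurentSeries (ZMod q)).coeff (((n + i : ℕ) : ℤ) + 1) := rfl

/-- The blocks `g_{n+1}, …, g_{n+m}` of all components of a vector of series. -/
def windowPi (q d n m : ℕ) : (Fin d → FracSeries q) →+ (Fin d → Fin m → ZMod q) where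
  toFun f j := window q n m (f j)
  map_zero' := by
    ext
    simp
  map_add' f g := by
    ext
    simp

theorem windowPi_apply {d : ℕ} (f : Fin d → FracSeries q) (n m : ℕ) (j : Fin d) :
    windowPi q d n m f j = window q n m (f j) := rfl

theorem coeff_fracPart_tVar_pow_mul (g : FracSeries q) (n i : ℕ) :
    ((fracPart (tVar q ^ n * (g : LaurentSeries (ZMod q))) : FracSeries q) :
      LaurentSeries (ZMod q)).coeff ((i : ℤ) + 1) =
      (g : LaurentSeries (ZMod q)).coeff (((n + i : ℕ) : ℤ) + 1) := by
  change (if (1 : ℤ) ≤ (i : ℤ) + 1 then _ else _) = _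
  rw [if_pos (by omega), tVar, HahnSeries.single_pow, HahnSeries.coeff_single_mul, one_pow, one_mul]
  congr 1
  simp
  ring

variable [Fact q.Prime]

theorem measurable_window (n m : ℕ) : Measurable (window q n m) := by
  refine measurable_pi_lambda _ fun i => Continuous.measurable ?_
  let _ : UniformSpace (ZMod q) := ⊥
  have h := (LaurentSeries.uniformContinuous_coeff (K := ZMod q) (((n + i : ℕ) : ℤ) + 1)).continuous
  exact h.comp continuous_subtype_val

theorem measurable_windowPi (d n m : ℕ) : Measurable (windowPi q d n m) :=
  measurable_pi_lambda _ fun j => (measurable_window n m).comp (measurable_pi_apply j)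

theorem window_surjective (n m : ℕ) : Function.Surjective (window q n m) := by
  intro w
  refine ⟨ofDigits fun i => if h : n ≤ i ∧ i - n < m then w ⟨i - n, h.2⟩ else 0, funext fun i => ?_⟩
  rw [window_apply, coeff_ofDigits, dif_pos (by constructor <;> omega)]
  congr 1
  ext
  simp

instance isProbabilityMeasure_haarFrac : IsProbabilityMeasure (haarFrac q) :=
  ⟨Measure.addHaarMeasure_self⟩

instance isAddLeftInvariant_haarFrac : (haarFrac q).IsAddLeftInvariant := by
  unfold haarFrac
  infer_instance

instance isProbabilityMeasure_haarFracPi (d : ℕ) : IsProbabilityMeasure (haarFracPi q d) := by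
  unfold haarFracPi
  infer_instance

instance isAddLeftInvariant_haarFracPi (d : ℕ) : (haarFracPi q d).IsAddLeftInvariant := by
  unfold haarFracPi
  infer_instance

/-- Windows of length `m` whose starting points differ by multiples of `m` do not overlap, so they
are independent. -/
theorem iIndepFun_windowPi (d c m : ℕ) (hm : 0 < m) :
    ProbabilityTheory.iIndepFun (fun k f => windowPi q d (c + k * m) m f) (haarFracPi q d) := by
  refine iIndepFun_of_jointly_surjective (fun k => windowPi q d (c + k * m) m)
    (fun k => measurable_windowPi _ _ _) fun w => ?_
  refine ⟨fun j => ofDigits fun i => w ((i - c) / m) j ⟨(i - c) % m, Nat.mod_lt _ hm⟩, fun k => ?_⟩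
  ext j i
  rw [windowPi_apply, window_apply, coeff_ofDigits]
  have h1 : c + k * m + (i : ℕ) - c = i + k * m := by omega
  congr 1
  · simp only [h1, Nat.add_mul_div_right _ _ hm, Nat.div_eq_of_lt i.2, zero_add]
  · ext
    simp only [h1, Nat.add_mul_mod_self_right, Nat.mod_eq_of_lt i.2]

/-- The integer whose base-`q` expansion is the word `w`, the leading digit coming first. -/
def wordVal {m : ℕ} (w : Fin m → ZMod q) : ℕ := ∑ i : Fin m, (w i.rev).val * q ^ (i : ℕ)

/-- Words of length `m` correspond to the integers below `q ^ m`. -/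
theorem card_wordVal_lt {m a : ℕ} (ha : a ≤ q ^ m) :
    (Finset.univ.filter fun w : Fin m → ZMod q => wordVal w < a).card = a := by
  have hq : 0 < q := (Fact.out : q.Prime).pos
  let e : (Fin m → ZMod q) ≃ Fin (q ^ m) :=
    (Equiv.arrowCongr Fin.revPerm (⟨fun x => ⟨x.val, ZMod.val_lt x⟩, fun y => (y : ℕ),
      fun x => by simp, fun y => by ext; simp [ZMod.val_natCast, Nat.mod_eq_of_lt y.2]⟩ :
        ZMod q ≃ Fin q)).trans finFunctionFinEquiv
  have he : ∀ w, (e w : ℕ) = wordVal w := fun w => rfl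
  have : (Finset.univ.filter fun w : Fin m → ZMod q => wordVal w < a) =
      (Finset.univ.filter fun k : Fin (q ^ m) => (k : ℕ) < a).map e.symm.toEmbedding := by
    ext w
    simp only [Finset.mem_filter, Finset.mem_univ, true_and, Finset.mem_map_equiv, Equiv.symm_symm,
      he]
  rw [this, Finset.card_map, Fin.card_filter_val_lt, min_eq_right ha]

/-- The `n`-th point of the sequence lies in the grid box `∏ [0, a_j / q^m)` with probability equal
to the volume of the box. -/
theorem measure_wordVal_lt (d n m : ℕ) (a : Fin d → ℕ) (ha : ∀ j, a j ≤ q ^ m) :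
    (haarFracPi q d).real {f | ∀ j, wordVal (windowPi q d n m f j) < a j} =
      ∏ j, (a j : ℝ) / (q : ℝ) ^ m := by
  have hset : {f : Fin d → FracSeries q | ∀ j, wordVal (windowPi q d n m f j) < a j} =
      Set.univ.pi fun j => window q n m ⁻¹'
        (Finset.univ.filter fun w : Fin m → ZMod q => wordVal w < a j : Finset _) := by
    ext f
    simp [windowPi]
  rw [hset, haarFracPi, measureReal_def, Measure.pi_pi, ENNReal.toReal_prod]
  refine Finset.prod_congr rfl fun j _ => ?_
  rw [measure_preimage_of_surjective_hom _ (measurable_window n m) (window_surjective n m),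
    card_wordVal_lt (ha j), Fintype.card_fun, ZMod.card, Fintype.card_fin]
  simp

/-- The window of length `m` determines the point `φ({tⁿ g})` up to an error of `q⁻ᵐ`. Both bounds
are attained: the upper one when all later digits are `q - 1`. -/
theorem wordVal_le_phi (g : FracSeries q) (n m : ℕ) :
    (wordVal (window q n m g) : ℝ) / (q : ℝ) ^ m ≤
        phi (fracPart (tVar q ^ n * (g : LaurentSeries (ZMod q)))) ∧
      phi (fracPart (tVar q ^ n * (g : LaurentSeries (ZMod q)))) ≤
        ((wordVal (window q n m g) : ℝ) + 1) / (q : ℝ) ^ m := by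
  have hq : (0 : ℝ) < q := by exact_mod_cast (Fact.out : q.Prime).pos
  let a : ℕ → Fin q := fun i =>
    ⟨((g : LaurentSeries (ZMod q)).coeff (((n + i : ℕ) : ℤ) + 1)).val, ZMod.val_lt _⟩
  have hphi : phi (fracPart (tVar q ^ n * (g : LaurentSeries (ZMod q)))) = Real.ofDigits a := by
    simp only [phi, coeff_fracPart_tVar_pow_mul, Real.ofDigits, Real.ofDigitsTerm, a,
      div_eq_mul_inv]
  have hpart : ∑ i ∈ Finset.range m, Real.ofDigitsTerm a i =
      (wordVal (window q n m g) : ℝ) / (q : ℝ) ^ m := by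
    rw [Finset.sum_range, wordVal, ← Equiv.sum_comp Fin.revPerm]
    push_cast
    rw [Finset.sum_div]
    refine Finset.sum_congr rfl fun i _ => ?_
    have hpow : (q : ℝ) ^ m = q ^ ((i.rev : ℕ) + 1) * q ^ (i : ℕ) := by
      rw [← pow_add, Fin.val_rev]
      congr 1
      omega
    simp only [Real.ofDigitsTerm, Fin.revPerm_apply, a, window, AddMonoidHom.coe_mk, ZeroHom.coe_mk]
    rw [hpow, div_eq_mul_inv, mul_inv]
    field_simp
  have h0 := Real.ofDigits_nonneg fun i => a (i + m)
  have h1 := Real.ofDigits_le_one fun i => a (i + m)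
  have hp : (0 : ℝ) < ((q : ℝ) ^ m)⁻¹ := by positivity
  rw [hphi, Real.ofDigits_eq_sum_add_ofDigits a m, hpart, add_div, one_div]
  constructor <;> nlinarith

end Windows

/-! ### A Bernstein inequality for sums with a finite range of dependence -/

section Concentration

variable {Ω : Type*} [MeasurableSpace Ω] {μ : Measure Ω} [IsProbabilityMeasure μ]

theorem integrable_of_abs_le {f : Ω → ℝ} (hf : Measurable f) {b : ℝ} (hb : ∀ ω, |f ω| ≤ b) :
    Integrable f μ :=
  Integrable.of_bound hf.aestronglyMeasurable b (ae_of_all _ hb)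

theorem mgf_le_exp_of_abs_le {f : Ω → ℝ} (hf : Measurable f) (hb : ∀ ω, |f ω| ≤ 2)
    (h0 : ∫ ω, f ω ∂μ = 0) {v : ℝ} (hv : ∫ ω, f ω ^ 2 ∂μ ≤ v) {s : ℝ} (hs : 2 * |s| ≤ 1) :
    ProbabilityTheory.mgf f μ s ≤ Real.exp (s ^ 2 * v) := by
  have hsf : ∀ ω, |s * f ω| ≤ 1 := fun ω => by
    rw [abs_mul]
    nlinarith [hb ω, abs_nonneg s, abs_nonneg (f ω)]
  have hi1 : Integrable f μ := integrable_of_abs_le hf hb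
  have hi2 : Integrable (fun ω => f ω ^ 2) μ :=
    integrable_of_abs_le (hf.pow_const 2) (b := 4) fun ω => by
      rw [abs_pow]
      nlinarith [hb ω, abs_nonneg (f ω)]
  have hie : Integrable (fun ω => Real.exp (s * f ω)) μ :=
    integrable_of_abs_le (by fun_prop) (b := Real.exp 1) fun ω => by
      rw [Real.abs_exp]
      exact Real.exp_le_exp.mpr (le_of_abs_le (hsf ω))
  calc ProbabilityTheory.mgf f μ s = ∫ ω, Real.exp (s * f ω) ∂μ := rfl
    _ ≤ ∫ ω, (1 + s * f ω + s ^ 2 * f ω ^ 2) ∂μ := by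
        refine integral_mono hie
          (((integrable_const 1).add (hi1.const_mul s)).add (hi2.const_mul _)) fun ω => ?_
        have := (abs_le.mp (Real.abs_exp_sub_one_sub_id_le (hsf ω))).2
        simp only
        nlinarith
    _ = 1 + s ^ 2 * ∫ ω, f ω ^ 2 ∂μ := by
        have hi3 : Integrable (fun ω => 1 + s * f ω) μ := (integrable_const 1).add (hi1.const_mul s)
        rw [integral_add hi3 (hi2.const_mul _),
          integral_add (integrable_const 1) (hi1.const_mul s), integral_const_mul,
          integral_const_mul, h0]
        simp
    _ ≤ s ^ 2 * v + 1 := by nlinarith [sq_nonneg s]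
    _ ≤ Real.exp (s ^ 2 * v) := Real.add_one_le_exp _

theorem sum_range_mul_eq_sum_residues (a : ℕ → ℝ) (K m : ℕ) :
    ∑ n ∈ Finset.range (K * m), a n =
      ∑ c ∈ Finset.range m, ∑ k ∈ Finset.range K, a (c + k * m) := by
  induction K with
  | zero => simp
  | succ K ih =>
    simp only [Finset.sum_range_succ, Finset.sum_add_distrib]
    rw [Nat.succ_mul, Finset.sum_range_add, ih]
    simp only [add_comm]

/-- Summands at distance `m` are independent. The sum splits into its `m` residue classes, each a
sum of independent terms, and convexity of the exponential function recombines them at the price of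
a factor `m` in the exponent. -/
theorem mgf_sum_range_mul_le {g : ℕ → Ω → ℝ} {m : ℕ} (hm : 0 < m)
    (hind : ∀ c, ProbabilityTheory.iIndepFun (fun k => g (c + k * m)) μ)
    (hg : ∀ n, Measurable (g n)) (hb : ∀ n ω, |g n ω| ≤ 2) (h0 : ∀ n, ∫ ω, g n ω ∂μ = 0)
    {v : ℝ} (hv : ∀ n, ∫ ω, g n ω ^ 2 ∂μ ≤ v) {s : ℝ} (hs : 2 * |s| * m ≤ 1) (K : ℕ) :
    ProbabilityTheory.mgf (fun ω => ∑ n ∈ Finset.range (K * m), g n ω) μ s ≤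
      Real.exp (s ^ 2 * m * (K * m) * v) := by
  have hm' : (0 : ℝ) < m := by exact_mod_cast hm
  let T : ℕ → Ω → ℝ := fun c => ∑ k ∈ Finset.range K, g (c + k * m)
  have hTm : ∀ c, Measurable (T c) := fun c => by
    have : T c = fun ω => ∑ k ∈ Finset.range K, g (c + k * m) ω := by
      ext ω
      simp [T]
    rw [this]
    exact Finset.measurable_sum _ fun k _ => hg _
  have hTb : ∀ c ω, |T c ω| ≤ K * 2 := fun c ω => by
    simp only [T, Finset.sum_apply]
    refine (Finset.abs_sum_le_sum_abs _ _).trans ?_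
    refine (Finset.sum_le_sum fun k _ => hb (c + k * m) ω).trans ?_
    simp
  have hTi : ∀ c, Integrable (fun ω => Real.exp (s * m * T c ω)) μ := fun c =>
    integrable_of_abs_le (by fun_prop) (b := Real.exp (|s * m| * (K * 2))) fun ω => by
      rw [Real.abs_exp]
      refine Real.exp_le_exp.mpr ((le_abs_self _).trans ?_)
      rw [abs_mul]
      exact mul_le_mul_of_nonneg_left (hTb c ω) (abs_nonneg _)
  have hclass : ∀ c, ∫ ω, Real.exp (s * m * T c ω) ∂μ ≤ Real.exp (s ^ 2 * m * (K * m) * v) := by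
    intro c
    have hmgf := (hind c).mgf_sum (t := s * m) (fun k => hg _) (Finset.range K)
    change ProbabilityTheory.mgf (T c) μ (s * m) = _ at hmgf
    change ProbabilityTheory.mgf (T c) μ (s * m) ≤ _
    rw [hmgf]
    calc ∏ k ∈ Finset.range K, ProbabilityTheory.mgf (g (c + k * m)) μ (s * m)
        ≤ ∏ _k ∈ Finset.range K, Real.exp ((s * m) ^ 2 * v) := by
          refine Finset.prod_le_prod (fun k _ => ProbabilityTheory.mgf_nonneg) fun k _ => ?_
          refine mgf_le_exp_of_abs_le (hg _) (hb _) (h0 _) (hv _) ?_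
          rw [abs_mul, abs_of_pos hm']
          linarith
      _ = Real.exp (s ^ 2 * m * (K * m) * v) := by
          rw [Finset.prod_const, Finset.card_range, ← Real.exp_nat_mul]
          congr 1
          ring
  have hconv : ∀ ω, Real.exp (s * ∑ n ∈ Finset.range (K * m), g n ω) ≤
      ∑ c ∈ Finset.range m, (m : ℝ)⁻¹ * Real.exp (s * m * T c ω) := by
    intro ω
    have h := convexOn_exp.map_sum_le (t := Finset.range m) (w := fun _ => (m : ℝ)⁻¹)
      (p := fun c => s * m * T c ω) (fun _ _ => by positivity) (by simp [hm'.ne'])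
      (fun _ _ => Set.mem_univ _)
    simp only [smul_eq_mul] at h
    refine le_trans (le_of_eq ?_) h
    rw [sum_range_mul_eq_sum_residues (fun n => g n ω), Finset.mul_sum]
    congr 1
    refine Finset.sum_congr rfl fun c _ => ?_
    simp only [T, Finset.sum_apply]
    field_simp
  calc ProbabilityTheory.mgf (fun ω => ∑ n ∈ Finset.range (K * m), g n ω) μ s
      = ∫ ω, Real.exp (s * ∑ n ∈ Finset.range (K * m), g n ω) ∂μ := rfl
    _ ≤ ∫ ω, ∑ c ∈ Finset.range m, (m : ℝ)⁻¹ * Real.exp (s * m * T c ω) ∂μ :=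
        integral_mono_of_nonneg (ae_of_all _ fun ω => (Real.exp_pos _).le)
          (integrable_finsetSum _ fun c _ => (hTi c).const_mul _) (ae_of_all _ hconv)
    _ = ∑ c ∈ Finset.range m, (m : ℝ)⁻¹ * ∫ ω, Real.exp (s * m * T c ω) ∂μ := by
        rw [integral_finsetSum _ fun c _ => (hTi c).const_mul _]
        simp only [integral_const_mul]
    _ ≤ ∑ _c ∈ Finset.range m, (m : ℝ)⁻¹ * Real.exp (s ^ 2 * m * (K * m) * v) :=
        Finset.sum_le_sum fun c _ => mul_le_mul_of_nonneg_left (hclass c) (by positivity)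
    _ = Real.exp (s ^ 2 * m * (K * m) * v) := by
        rw [Finset.sum_const, Finset.card_range, nsmul_eq_mul, ← mul_assoc,
          mul_inv_cancel₀ hm'.ne', one_mul]

theorem mgf_sum_range_le {g : ℕ → Ω → ℝ} {m : ℕ} (hm : 0 < m)
    (hind : ∀ c, ProbabilityTheory.iIndepFun (fun k => g (c + k * m)) μ)
    (hg : ∀ n, Measurable (g n)) (hb : ∀ n ω, |g n ω| ≤ 2) (h0 : ∀ n, ∫ ω, g n ω ∂μ = 0)
    {v : ℝ} (hv : ∀ n, ∫ ω, g n ω ^ 2 ∂μ ≤ v) {s : ℝ} (hs : 2 * |s| * m ≤ 1) (N : ℕ) :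
    ProbabilityTheory.mgf (fun ω => ∑ n ∈ Finset.range N, g n ω) μ s ≤
      Real.exp (s ^ 2 * m * (N + m) * v) := by
  have hv0 : 0 ≤ v := (integral_nonneg fun ω => sq_nonneg (g 0 ω)).trans (hv 0)
  -- Replace the terms with `n ≥ N` by zero to reach a number of terms divisible by `m`.
  let g' : ℕ → Ω → ℝ := fun n ω => if n < N then g n ω else 0
  have hKN : N ≤ (N / m + 1) * m := by
    have := Nat.div_add_mod N m
    have := Nat.mod_lt N hm
    nlinarith
  have hsum : (fun ω => ∑ n ∈ Finset.range N, g n ω) =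
      fun ω => ∑ n ∈ Finset.range ((N / m + 1) * m), g' n ω := by
    ext ω
    rw [← Finset.sum_subset (Finset.range_subset_range.mpr hKN)
      (fun n _ hn => if_neg (by simpa using hn))]
    exact Finset.sum_congr rfl fun n hn => (if_pos (Finset.mem_range.mp hn)).symm
  rw [hsum]
  refine (mgf_sum_range_mul_le hm (g := g') (v := v) (fun c => ?_) (fun n => ?_) (fun n ω => ?_)
    (fun n => ?_) (fun n => ?_) hs _).trans (Real.exp_le_exp.mpr ?_)
  · exact (hind c).comp (fun k x => if c + k * m < N then x else 0) fun k => by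
      by_cases h : c + k * m < N <;> simp [h, measurable_id']
  · by_cases h : n < N <;> simp [g', h, hg n]
  · by_cases h : n < N <;> simp [g', h, hb n ω]
  · by_cases h : n < N <;> simp [g', h, h0 n]
  · by_cases h : n < N <;> simp [g', h, hv n, hv0]
  · have : ((N / m + 1 : ℕ) : ℝ) * m ≤ N + m := by
      have := Nat.div_mul_le_self N m
      exact_mod_cast (by nlinarith : (N / m + 1) * m ≤ N + m)
    gcongr

/-- The Bernstein inequality in the form used for the chaining increments; `s` is a free parameter. -/
theorem measure_abs_sum_range_ge_le {g : ℕ → Ω → ℝ} {m : ℕ} (hm : 0 < m)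
    (hind : ∀ c, ProbabilityTheory.iIndepFun (fun k => g (c + k * m)) μ)
    (hg : ∀ n, Measurable (g n)) (hb : ∀ n ω, |g n ω| ≤ 2) (h0 : ∀ n, ∫ ω, g n ω ∂μ = 0)
    {v : ℝ} (hv : ∀ n, ∫ ω, g n ω ^ 2 ∂μ ≤ v) {s : ℝ} (hs0 : 0 ≤ s) (hs : 2 * s * m ≤ 1) (N : ℕ)
    (τ : ℝ) :
    μ.real {ω | τ ≤ |∑ n ∈ Finset.range N, g n ω|} ≤
      2 * Real.exp (s ^ 2 * m * (N + m) * v - s * τ) := by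
  have hSm : Measurable fun ω => ∑ n ∈ Finset.range N, g n ω :=
    Finset.measurable_sum _ fun n _ => hg n
  have hSb : ∀ ω, |∑ n ∈ Finset.range N, g n ω| ≤ N * 2 := fun ω => by
    refine (Finset.abs_sum_le_sum_abs _ _).trans ?_
    refine (Finset.sum_le_sum fun n _ => hb n ω).trans ?_
    simp
  have hint : ∀ t : ℝ, Integrable (fun ω => Real.exp (t * ∑ n ∈ Finset.range N, g n ω)) μ :=
    fun t => integrable_of_abs_le (by fun_prop) (b := Real.exp (|t| * (N * 2))) fun ω => by
      rw [Real.abs_exp]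
      refine Real.exp_le_exp.mpr ((le_abs_self _).trans ?_)
      rw [abs_mul]
      exact mul_le_mul_of_nonneg_left (hSb ω) (abs_nonneg _)
  have hup := ProbabilityTheory.measure_ge_le_exp_mul_mgf τ hs0 (hint s)
  have hlow := ProbabilityTheory.measure_le_le_exp_mul_mgf (-τ) (neg_nonpos.mpr hs0) (hint (-s))
  have hmgf : ∀ t, |t| = s → ProbabilityTheory.mgf (fun ω => ∑ n ∈ Finset.range N, g n ω) μ t ≤
      Real.exp (s ^ 2 * m * (N + m) * v) := by
    intro t ht
    rw [← ht, sq_abs]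
    exact mgf_sum_range_le hm hind hg hb h0 hv (by rw [ht]; exact hs) N
  have hcover : {ω | τ ≤ |∑ n ∈ Finset.range N, g n ω|} ⊆
      {ω | τ ≤ ∑ n ∈ Finset.range N, g n ω} ∪ {ω | ∑ n ∈ Finset.range N, g n ω ≤ -τ} := by
    intro ω hω
    simp only [Set.mem_ofPred_eq, Set.mem_union, le_abs] at hω ⊢
    exact hω.imp_right le_neg_of_le_neg
  have hexp : Real.exp (s ^ 2 * m * (N + m) * v - s * τ) =
      Real.exp (-s * τ) * Real.exp (s ^ 2 * m * (N + m) * v) := by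
    rw [← Real.exp_add]
    congr 1
    ring
  refine (measureReal_mono hcover).trans ((measureReal_union_le _ _).trans ?_)
  have h1 := hup.trans (mul_le_mul_of_nonneg_left (hmgf s (abs_of_nonneg hs0)) (Real.exp_pos _).le)
  have h2 := hlow.trans (mul_le_mul_of_nonneg_left
    (hmgf (-s) (by rw [abs_neg, abs_of_nonneg hs0])) (Real.exp_pos _).le)
  rw [show - -s * -τ = -s * τ by ring] at h2
  rw [hexp]
  linarith

end Concentration

/-! ### Bracketing covers of anchored boxes by grid boxes -/

section Cover

theorem prod_sub_prod_le_sum {ι : Type*} (S : Finset ι) {x y : ι → ℝ} (hy : ∀ i, 0 ≤ y i)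
    (hyx : ∀ i, y i ≤ x i) (hx : ∀ i, x i ≤ 1) :
    ∏ i ∈ S, x i - ∏ i ∈ S, y i ≤ ∑ i ∈ S, (x i - y i) := by
  classical
  induction S using Finset.induction_on with
  | empty => simp
  | insert i S hi ih =>
    rw [Finset.prod_insert hi, Finset.prod_insert hi, Finset.sum_insert hi]
    have h1 : ∏ j ∈ S, x j ≤ 1 := Finset.prod_le_one (fun j _ => (hy j).trans (hyx j)) fun j _ => hx j
    have h2 : ∏ j ∈ S, y j ≤ ∏ j ∈ S, x j :=
      Finset.prod_le_prod (fun j _ => hy j) fun j _ => hyx j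
    have h3 := hy i
    have h4 := hyx i
    have h5 := hx i
    nlinarith

/-- A box of volume at most `c` is contained in a box of volume exactly `c`. -/
theorem exists_ge_prod_eq {ι : Type*} [Fintype ι] {t : ι → ℝ} (ht1 : ∀ i, t i ≤ 1) {c : ℝ}
    (hc : ∏ i, t i ≤ c) (hc1 : c ≤ 1) :
    ∃ s : ι → ℝ, (∀ i, t i ≤ s i) ∧ (∀ i, s i ≤ 1) ∧ ∏ i, s i = c := by
  let F : ℝ → ℝ := fun θ => ∏ i, (t i + θ * (1 - t i))
  have hF : ContinuousOn F (Set.Icc 0 1) := by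
    apply Continuous.continuousOn
    fun_prop
  obtain ⟨θ, hθ, hθc⟩ := intermediate_value_Icc zero_le_one hF
    (show c ∈ Set.Icc (F 0) (F 1) by simp [F, hc, hc1])
  refine ⟨fun i => t i + θ * (1 - t i), fun i => ?_, fun i => ?_, hθc⟩
  · nlinarith [ht1 i, hθ.1]
  · nlinarith [ht1 i, hθ.2]

/-- The number of `k ∈ ℕ^d` with `∑ k_j ≤ d M` is at most `(3 (M + 1)) ^ d`: compare with the
generating function `(∑ x ^ i) ^ d` at `x = M / (M + 1)`. -/
theorem card_sum_le (d M : ℕ) (hM : 0 < M) :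
    (((Fintype.piFinset fun _ : Fin d => Finset.range (d * M + 1)).filter
      fun k => ∑ j, k j ≤ d * M).card : ℝ) ≤ (3 * (M + 1)) ^ d := by
  have hM' : (0 : ℝ) < M := by exact_mod_cast hM
  set x : ℝ := M / (M + 1) with hx
  have hx0 : 0 < x := by positivity
  have hx1 : x < 1 := by
    rw [hx, div_lt_one (by positivity)]
    linarith
  set P := Fintype.piFinset fun _ : Fin d => Finset.range (d * M + 1)
  have hgeom : ∑ i ∈ Finset.range (d * M + 1), x ^ i ≤ M + 1 := by
    have h := (summable_geometric_of_lt_one hx0.le hx1).sum_le_tsum (Finset.range (d * M + 1))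
      (fun i _ => by positivity)
    rw [tsum_geometric_of_lt_one hx0.le hx1] at h
    refine h.trans (le_of_eq ?_)
    rw [hx]
    field_simp
    ring
  have hgen : ((P.filter fun k => ∑ j, k j ≤ d * M).card : ℝ) * x ^ (d * M) ≤ (M + 1) ^ d := by
    calc ((P.filter fun k => ∑ j, k j ≤ d * M).card : ℝ) * x ^ (d * M)
        = ∑ _k ∈ P.filter (fun k => ∑ j, k j ≤ d * M), x ^ (d * M) := by
          rw [Finset.sum_const, nsmul_eq_mul]
      _ ≤ ∑ k ∈ P.filter (fun k => ∑ j, k j ≤ d * M), ∏ j, x ^ k j := by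
          refine Finset.sum_le_sum fun k hk => ?_
          rw [Finset.prod_pow_eq_pow_sum]
          exact pow_le_pow_of_le_one hx0.le hx1.le (Finset.mem_filter.mp hk).2
      _ ≤ ∑ k ∈ P, ∏ j, x ^ k j :=
          Finset.sum_le_sum_of_subset_of_nonneg (Finset.filter_subset _ _)
            fun k _ _ => by positivity
      _ = ∏ _j : Fin d, ∑ i ∈ Finset.range (d * M + 1), x ^ i := by
          rw [Finset.prod_univ_sum]
      _ ≤ ∏ _j : Fin d, ((M : ℝ) + 1) :=
          Finset.prod_le_prod (fun _ _ => by positivity) fun _ _ => hgeom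
      _ = (M + 1) ^ d := by simp
  have hxM : (x ^ M)⁻¹ ≤ 3 := by
    have h1 : (x ^ M)⁻¹ = (1 + (M : ℝ)⁻¹) ^ M := by
      rw [← inv_pow, hx]
      congr 1
      field_simp
    have h2 : 1 + (M : ℝ)⁻¹ ≤ Real.exp ((M : ℝ)⁻¹) := by
      linarith [Real.add_one_le_exp ((M : ℝ)⁻¹)]
    rw [h1]
    calc (1 + (M : ℝ)⁻¹) ^ M ≤ Real.exp ((M : ℝ)⁻¹) ^ M := by gcongr
      _ = Real.exp 1 := by
          rw [← Real.exp_nat_mul, mul_inv_cancel₀ hM'.ne']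
      _ ≤ 3 := Real.exp_one_lt_three.le
  have hxd : (x ^ (d * M))⁻¹ ≤ 3 ^ d := by
    rw [mul_comm, pow_mul, ← inv_pow]
    gcongr
  rw [← le_div_iff₀ (by positivity)] at hgen
  refine hgen.trans ?_
  rw [div_eq_mul_inv, mul_pow, mul_comm]
  gcongr

/-- There is a set `Γ` of at most `exp (d (3 + 3 h))` boxes with corners on the grid `Q⁻¹ ℤ^d` such
that every anchored box lies between two members of `Γ` whose volumes differ by at most `3 / 4 ^ h`.

The numbers `-log t_j` are rounded to multiples of `δ / d`, `δ = 4⁻ʰ`. For boxes of volume at least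
`δ` the sum of the resulting integers is `O(d h / δ)`, which makes the cardinality independent of
the grid: rounding each `t_j` itself would cost an additional factor `d ^ d`. The lower corner is
strictly below `t` unless its box is empty. -/
theorem exists_bracketing_cover (d h Q : ℕ) (hd : 0 < d) (hQ : d * 4 ^ h ≤ Q) :
    ∃ Γ : Finset (Fin d → ℕ), 0 ∈ Γ ∧ (∀ a ∈ Γ, ∀ j, a j ≤ Q) ∧
      (Γ.card : ℝ) ≤ Real.exp (d * (3 + 3 * h)) ∧
      ∀ t : Fin d → ℝ, (∀ j, t j ∈ Set.Icc (0 : ℝ) 1) → ∃ l ∈ Γ, ∃ u ∈ Γ,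
        ((∀ j, (l j : ℝ) < t j * Q) ∨ ∃ j, l j = 0) ∧ (∀ j, t j * Q ≤ u j) ∧
        ∏ j, (u j : ℝ) / Q - ∏ j, (l j : ℝ) / Q ≤ 3 / 4 ^ h := by
  classical
  have hd' : (0 : ℝ) < d := by exact_mod_cast hd
  have hQ' : (d : ℝ) * 4 ^ h ≤ Q := by exact_mod_cast hQ
  have hQ0 : (0 : ℝ) < Q := lt_of_lt_of_le (by positivity) hQ'
  set δ : ℝ := 1 / 4 ^ h with hδ
  have hδ0 : 0 < δ := by positivity
  have hδ1 : δ ≤ 1 := by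
    rw [hδ, div_le_one (by positivity)]
    exact one_le_pow₀ (by norm_num)
  have hdQ : (d : ℝ) * (1 / Q) ≤ δ := by
    rw [hδ, mul_one_div, div_le_div_iff₀ hQ0 (by positivity)]
    linarith
  set M : ℕ := 2 * h * 4 ^ h + 1 with hM
  let K := (Fintype.piFinset fun _ : Fin d => Finset.range (d * M + 1)).filter
    fun k => ∑ j, k j ≤ d * M
  let p : (Fin d → ℕ) → Fin d → ℝ := fun k j => Real.exp (-((k j : ℝ) * (δ / d)))
  have hp0 : ∀ k j, 0 < p k j := fun k j => Real.exp_pos _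
  have hp1 : ∀ k j, p k j ≤ 1 := fun k j => Real.exp_le_one_iff.mpr (by
    have : 0 ≤ (k j : ℝ) * (δ / d) := by positivity
    linarith)
  let U : (Fin d → ℕ) → Fin d → ℕ := fun k j => ⌈Q * p k j⌉₊
  let L : (Fin d → ℕ) → Fin d → ℕ := fun k j => ⌊Q * p (fun i => k i + 1) j⌋₊
  have hUQ : ∀ k j, U k j ≤ Q := fun k j =>
    Nat.ceil_le.mpr (mul_le_of_le_one_right hQ0.le (hp1 k j))
  have hLQ : ∀ k j, L k j ≤ Q := fun k j =>
    Nat.floor_le_of_le (mul_le_of_le_one_right hQ0.le (hp1 (fun i => k i + 1) j))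
  -- Rounding to the grid changes a product by at most `d / Q ≤ δ`.
  have hUprod : ∀ k, ∏ j, (U k j : ℝ) / Q ≤ ∏ j, p k j + δ := by
    intro k
    have h := prod_sub_prod_le_sum Finset.univ (x := fun j => (U k j : ℝ) / Q) (y := p k)
      (fun j => (hp0 k j).le)
      (fun j => by rw [le_div_iff₀ hQ0, mul_comm]; exact Nat.le_ceil _)
      (fun j => by rw [div_le_one hQ0]; exact_mod_cast hUQ k j)
    have h2 : ∑ j, ((U k j : ℝ) / Q - p k j) ≤ ∑ _j : Fin d, 1 / (Q : ℝ) := by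
      refine Finset.sum_le_sum fun j _ => ?_
      have := (Nat.ceil_lt_add_one (mul_nonneg hQ0.le (hp0 k j).le)).le
      rw [sub_le_iff_le_add, div_le_iff₀ hQ0, add_mul, one_div, inv_mul_cancel₀ hQ0.ne']
      linarith
    simp only [Finset.sum_const, Finset.card_univ, Fintype.card_fin, nsmul_eq_mul] at h2
    linarith
  have hLprod : ∀ k, ∏ j, p (fun i => k i + 1) j - δ ≤ ∏ j, (L k j : ℝ) / Q := by
    intro k
    have h := prod_sub_prod_le_sum Finset.univ (x := p (fun i => k i + 1))
      (y := fun j => (L k j : ℝ) / Q) (fun j => by positivity)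
      (fun j => by
        rw [div_le_iff₀ hQ0, mul_comm]
        exact Nat.floor_le (mul_nonneg hQ0.le (hp0 (fun i => k i + 1) j).le))
      (fun j => hp1 (fun i => k i + 1) j)
    have h2 : ∑ j, (p (fun i => k i + 1) j - (L k j : ℝ) / Q) ≤ ∑ _j : Fin d, 1 / (Q : ℝ) := by
      refine Finset.sum_le_sum fun j _ => ?_
      have := (Nat.lt_floor_add_one (Q * p (fun i => k i + 1) j)).le
      rw [sub_le_iff_le_add, ← add_div, le_div_iff₀ hQ0]
      linarith
    simp only [Finset.sum_const, Finset.card_univ, Fintype.card_fin, nsmul_eq_mul] at h2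
    linarith
  -- One rounding step in every coordinate multiplies the volume by `exp (-δ) ≥ 1 - δ`.
  have hstep : ∀ k, ∏ j, p (fun i => k i + 1) j = (∏ j, p k j) * Real.exp (-δ) := by
    intro k
    simp only [p]
    rw [← Real.exp_sum, ← Real.exp_sum, ← Real.exp_add]
    congr 1
    push_cast
    simp only [add_mul, one_mul, neg_add, Finset.sum_add_distrib, Finset.sum_const,
      Finset.card_univ, Fintype.card_fin, nsmul_eq_mul]
    rw [mul_neg, mul_div_cancel₀ δ hd'.ne']
  have hexp : 1 - δ ≤ Real.exp (-δ) := by linarith [Real.add_one_le_exp (-δ)]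
  have hpprod1 : ∀ k, ∏ j, p k j ≤ 1 := fun k =>
    Finset.prod_le_one (fun j _ => (hp0 k j).le) fun j _ => hp1 k j
  have hpprod0 : ∀ k, 0 < ∏ j, p k j := fun k => Finset.prod_pos fun j _ => hp0 k j
  refine ⟨insert 0 (K.image U ∪ K.image L), Finset.mem_insert_self _ _, ?_, ?_, ?_⟩
  · intro a ha j
    simp only [Finset.mem_insert, Finset.mem_union, Finset.mem_image] at ha
    rcases ha with rfl | ⟨k, -, rfl⟩ | ⟨k, -, rfl⟩
    · exact Nat.zero_le _
    · exact hUQ k j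
    · exact hLQ k j
  · have hcard : (insert 0 (K.image U ∪ K.image L)).card ≤ 2 * K.card + 1 := by
      refine (Finset.card_insert_le _ _).trans (Nat.succ_le_succ ?_)
      refine (Finset.card_union_le _ _).trans ?_
      have := Finset.card_image_le (s := K) (f := U)
      have := Finset.card_image_le (s := K) (f := L)
      omega
    have hK : (K.card : ℝ) ≤ (3 * (M + 1)) ^ d := card_sum_le d M (by omega)
    have hM8 : (3 * ((M : ℝ) + 1)) ≤ 6 * 8 ^ h := by
      have h1 : h + 1 ≤ 2 ^ h := Nat.lt_two_pow_self
      have h2 : M + 1 ≤ 2 * 8 ^ h := by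
        have h3 : 1 ≤ 4 ^ h := Nat.one_le_pow _ _ (by norm_num)
        calc M + 1 = 2 * h * 4 ^ h + 2 := by rw [hM]
          _ ≤ 2 * ((h + 1) * 4 ^ h) := by nlinarith
          _ ≤ 2 * (2 ^ h * 4 ^ h) := by gcongr
          _ = 2 * 8 ^ h := by rw [← mul_pow]; norm_num
      have : ((M : ℝ) + 1) ≤ 2 * 8 ^ h := by exact_mod_cast h2
      linarith
    have he : (18 : ℝ) ≤ Real.exp 3 := by
      have h1 : (2.7 : ℝ) ≤ Real.exp 1 := by linarith [Real.exp_one_gt_d9]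
      have h2 : Real.exp 3 = Real.exp 1 ^ 3 := by
        rw [← Real.exp_nat_mul]
        norm_num
      rw [h2]
      calc (18 : ℝ) ≤ 2.7 ^ 3 := by norm_num
        _ ≤ Real.exp 1 ^ 3 := by gcongr
    calc ((insert 0 (K.image U ∪ K.image L)).card : ℝ) ≤ 2 * K.card + 1 := by exact_mod_cast hcard
      _ ≤ 2 * (6 * 8 ^ h) ^ d + 1 := by
          have : (3 * ((M : ℝ) + 1)) ^ d ≤ (6 * 8 ^ h) ^ d := by gcongr
          linarith
      _ ≤ 3 * (6 * 8 ^ h) ^ d := by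
          have : (1 : ℝ) ≤ (6 * 8 ^ h) ^ d :=
            one_le_pow₀ (by have : (1 : ℝ) ≤ 8 ^ h := one_le_pow₀ (by norm_num)
                            linarith)
          linarith
      _ ≤ 3 ^ d * (6 * 8 ^ h) ^ d := by
          gcongr
          exact le_self_pow₀ (by norm_num) hd.ne'
      _ = (18 * 8 ^ h) ^ d := by
          rw [← mul_pow, ← mul_assoc]
          norm_num
      _ ≤ (Real.exp 3 * Real.exp 3 ^ h) ^ d := by
          gcongr
          linarith
      _ = Real.exp (d * (3 + 3 * h)) := by
          rw [← Real.exp_nat_mul, ← Real.exp_add, ← Real.exp_nat_mul]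
          congr 2
          ring
  · intro t ht
    -- Enlarge `t` to a box of volume at least `δ`, whose sides are then positive.
    obtain ⟨s, hts, hs1, hsδ, hst⟩ : ∃ s : Fin d → ℝ, (∀ j, t j ≤ s j) ∧ (∀ j, s j ≤ 1) ∧
        δ ≤ ∏ j, s j ∧ (s = t ∨ ∏ j, s j = δ) := by
      by_cases hcase : δ ≤ ∏ j, t j
      · exact ⟨t, fun _ => le_rfl, fun j => (ht j).2, hcase, Or.inl rfl⟩
      · obtain ⟨s, h1, h2, h3⟩ := exists_ge_prod_eq (fun j => (ht j).2) (not_le.mp hcase).le hδ1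
        exact ⟨s, h1, h2, h3.ge, Or.inr h3⟩
    have hs0 : ∀ j, 0 < s j := by
      intro j
      refine lt_of_le_of_ne ((ht j).1.trans (hts j)) fun h => ?_
      rw [Finset.prod_eq_zero (Finset.mem_univ j) h.symm] at hsδ
      linarith
    set k : Fin d → ℕ := fun j => ⌊-Real.log (s j) / (δ / d)⌋₊ with hk
    have hx0 : ∀ j, 0 ≤ -Real.log (s j) / (δ / d) := fun j =>
      div_nonneg (neg_nonneg.mpr (Real.log_nonpos (hs0 j).le (hs1 j))) (by positivity)
    have hsp : ∀ j, s j ≤ p k j := by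
      intro j
      have h := Nat.floor_le (hx0 j)
      rw [le_div_iff₀ (by positivity)] at h
      rw [← Real.exp_log (hs0 j)]
      exact Real.exp_le_exp.mpr (by simp only [hk]; linarith)
    have hps : ∀ j, p (fun i => k i + 1) j < s j := by
      intro j
      have h := Nat.lt_floor_add_one (-Real.log (s j) / (δ / d))
      rw [div_lt_iff₀ (by positivity)] at h
      rw [← Real.exp_log (hs0 j)]
      exact Real.exp_lt_exp.mpr (by simp only [hk]; push_cast; linarith)
    have hksum : ∑ j, k j ≤ d * M := by
      have hlog : -Real.log δ ≤ 2 * h := by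
        rw [hδ, one_div, Real.log_inv, neg_neg, Real.log_pow]
        have h4 : Real.log 4 ≤ 2 := by
          rw [show (4 : ℝ) = 2 ^ 2 by norm_num, Real.log_pow]
          have := Real.log_two_lt_d9
          push_cast
          linarith
        have : (0 : ℝ) ≤ h := by positivity
        nlinarith
      have h1 : (∑ j, (k j : ℝ)) ≤ d * (2 * h * 4 ^ h) := by
        calc (∑ j, (k j : ℝ)) ≤ ∑ j, -Real.log (s j) / (δ / d) :=
              Finset.sum_le_sum fun j _ => Nat.floor_le (hx0 j)
          _ = -Real.log (∏ j, s j) / (δ / d) := by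
              rw [Real.log_prod fun j _ => (hs0 j).ne', ← Finset.sum_div, Finset.sum_neg_distrib]
          _ ≤ 2 * h / (δ / d) := by
              have := Real.log_le_log hδ0 hsδ
              gcongr
              linarith
          _ = d * (2 * h * 4 ^ h) := by
              rw [hδ]
              field_simp
      have h2 : ∑ j, k j ≤ d * (2 * h * 4 ^ h) := by exact_mod_cast h1
      exact h2.trans (Nat.mul_le_mul_left _ (by omega))
    have hkK : k ∈ K := by
      refine Finset.mem_filter.mpr ⟨Fintype.mem_piFinset.mpr fun j => ?_, hksum⟩
      have := Finset.single_le_sum (f := k) (fun _ _ => Nat.zero_le _) (Finset.mem_univ j)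
      exact Finset.mem_range.mpr (by omega)
    have hupper : ∀ j, t j * Q ≤ U k j := fun j => by
      refine le_trans ?_ (Nat.le_ceil _)
      rw [mul_comm]
      exact mul_le_mul_of_nonneg_left ((hts j).trans (hsp j)) hQ0.le
    have hlow : ∏ j, p (fun i => k i + 1) j ≤ ∏ j, s j :=
      Finset.prod_le_prod (fun j _ => (hp0 (fun i => k i + 1) j).le) fun j _ => (hps j).le
    have hgap : ∏ j, p k j ≤ ∏ j, p (fun i => k i + 1) j + δ := by
      rw [hstep k]
      nlinarith [hpprod1 k, hpprod0 k]
    have h3 : 3 / (4 : ℝ) ^ h = 3 * δ := by rw [hδ]; ring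
    have hUk := hUprod k
    have hUmem : U k ∈ insert 0 (K.image U ∪ K.image L) :=
      Finset.mem_insert_of_mem (Finset.mem_union_left _ (Finset.mem_image_of_mem _ hkK))
    rw [h3]
    rcases hst with rfl | hst
    · refine ⟨L k, Finset.mem_insert_of_mem (Finset.mem_union_right _
        (Finset.mem_image_of_mem _ hkK)), U k, hUmem, Or.inl fun j => ?_, hupper, ?_⟩
      · refine (Nat.floor_le (mul_nonneg hQ0.le (hp0 (fun i => k i + 1) j).le)).trans_lt ?_
        rw [mul_comm (s j)]
        exact mul_lt_mul_of_pos_left (hps j) hQ0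
      · have := hLprod k
        linarith
    · refine ⟨0, Finset.mem_insert_self _ _, U k, hUmem, Or.inr ⟨⟨0, hd⟩, rfl⟩, hupper, ?_⟩
      have : (0 : ℝ) ≤ ∏ j : Fin d, (((0 : Fin d → ℕ) j : ℕ) : ℝ) / Q :=
        Finset.prod_nonneg fun j _ => by positivity
      linarith

end Cover

/-! ### Deviations of grid boxes -/

section GridBoxes

variable {q d : ℕ}

/-- The indicator function of the event that the `n`-th point of the sequence lies in the box
`∏ [0, a_j / q ^ m)`. It is read off from the first `m` digits of the point, so that the event is
decided by finitely many digits even when the later digits of a coordinate are all `q - 1`. -/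
noncomputable def gridInd (m : ℕ) (a : Fin d → ℕ) (n : ℕ) (f : Fin d → FracSeries q) : ℝ :=
  open Classical in if ∀ j, wordVal (windowPi q d n m f j) < a j then 1 else 0

/-- The volume of the box `∏ [0, a_j / q ^ m)`. -/
noncomputable def gridVol (q : ℕ) (m : ℕ) (a : Fin d → ℕ) : ℝ := ∏ j, (a j : ℝ) / (q : ℝ) ^ m

/-- The number of the first `N` points in the box `∏ [0, a_j / q ^ m)`, minus its expectation. -/
noncomputable def gridDev (N m : ℕ) (a : Fin d → ℕ) (f : Fin d → FracSeries q) : ℝ :=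
  ∑ n ∈ Finset.range N, (gridInd m a n f - gridVol q m a)

theorem gridInd_nonneg (m : ℕ) (a : Fin d → ℕ) (n : ℕ) (f : Fin d → FracSeries q) :
    0 ≤ gridInd m a n f := by
  unfold gridInd
  split_ifs <;> norm_num

theorem gridInd_le_one (m : ℕ) (a : Fin d → ℕ) (n : ℕ) (f : Fin d → FracSeries q) :
    gridInd m a n f ≤ 1 := by
  unfold gridInd
  split_ifs <;> norm_num

theorem gridInd_zero (hd : 0 < d) (m n : ℕ) (f : Fin d → FracSeries q) :
    gridInd m (0 : Fin d → ℕ) n f = 0 :=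
  if_neg fun h => Nat.not_lt_zero _ (h ⟨0, hd⟩)

theorem gridVol_zero (hd : 0 < d) (m : ℕ) : gridVol q m (0 : Fin d → ℕ) = 0 :=
  Finset.prod_eq_zero (Finset.mem_univ ⟨0, hd⟩) (by simp)

theorem gridDev_zero (hd : 0 < d) (N m : ℕ) (f : Fin d → FracSeries q) :
    gridDev N m (0 : Fin d → ℕ) f = 0 := by
  simp [gridDev, gridInd_zero hd, gridVol_zero hd]

/-- The box indicator at resolution `q⁻ᵐ` as a function of a longer word. -/
theorem exists_gridInd_eq_comp_window {m m' : ℕ} (h : m ≤ m') (a : Fin d → ℕ) :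
    ∃ F : (Fin d → Fin m' → ZMod q) → ℝ, ∀ n f, gridInd m a n f = F (windowPi q d n m' f) := by
  classical
  refine ⟨fun w => if ∀ j, wordVal (fun i : Fin m => w j (Fin.castLE h i)) < a j then 1 else 0,
    fun n f => ?_⟩
  unfold gridInd
  congr

variable [Fact q.Prime]

theorem measurable_gridInd (m : ℕ) (a : Fin d → ℕ) (n : ℕ) :
    Measurable (gridInd (q := q) m a n) := by
  obtain ⟨F, hF⟩ := exists_gridInd_eq_comp_window (q := q) le_rfl a
  have : gridInd (q := q) m a n = F ∘ windowPi q d n m := funext fun f => hF n f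
  rw [this]
  exact Measurable.of_discrete.comp (measurable_windowPi d n m)

theorem integrable_gridInd (m : ℕ) (a : Fin d → ℕ) (n : ℕ) :
    Integrable (gridInd (q := q) m a n) (haarFracPi q d) :=
  integrable_of_abs_le (measurable_gridInd m a n) (b := 1) fun f =>
    abs_le.mpr ⟨by linarith [gridInd_nonneg m a n f], gridInd_le_one m a n f⟩

theorem integral_gridInd (m : ℕ) (a : Fin d → ℕ) (ha : ∀ j, a j ≤ q ^ m) (n : ℕ) :
    ∫ f, gridInd (q := q) m a n f ∂haarFracPi q d = gridVol q m a := by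
  have hset : MeasurableSet {f : Fin d → FracSeries q |
      ∀ j, wordVal (windowPi q d n m f j) < a j} :=
    measurable_windowPi d n m
      (MeasurableSet.of_discrete (s := {w : Fin d → Fin m → ZMod q | ∀ j, wordVal (w j) < a j}))
  have : gridInd (q := q) m a n = {f : Fin d → FracSeries q |
      ∀ j, wordVal (windowPi q d n m f j) < a j}.indicator 1 := by
    ext f
    simp [gridInd, Set.indicator_apply]
  rw [this, integral_indicator_one hset, measure_wordVal_lt d n m a ha, gridVol]

/-- The increments of the chaining argument: the deviations of two boxes differ by more than `τ`
with exponentially small probability, at a rate governed by the measure `v` of the symmetric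
difference and the number `m'` of digits involved. -/
theorem measure_gridDev_sub_ge_le {m m' : ℕ} (hm' : 0 < m') (hmm : m ≤ m') {a b : Fin d → ℕ}
    (ha : ∀ j, a j ≤ q ^ m) (hb : ∀ j, b j ≤ q ^ m') {v : ℝ}
    (hv : ∀ n, ∫ f, |gridInd (q := q) m' b n f - gridInd m a n f| ∂haarFracPi q d ≤ v)
    {s : ℝ} (hs0 : 0 ≤ s) (hs : 2 * s * m' ≤ 1) (N : ℕ) (τ : ℝ) :
    (haarFracPi q d).real {f | τ ≤ |gridDev N m' b f - gridDev N m a f|} ≤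
      2 * Real.exp (s ^ 2 * m' * (N + m') * v - s * τ) := by
  let X : ℕ → (Fin d → FracSeries q) → ℝ := fun n f => gridInd m' b n f - gridInd m a n f
  let e : ℝ := gridVol q m' b - gridVol q m a
  have hXm : ∀ n, Measurable (X n) := fun n => (measurable_gridInd _ _ _).sub (measurable_gridInd _ _ _)
  have hX1 : ∀ n f, |X n f| ≤ 1 := fun n f => by
    have h1 := gridInd_nonneg m' b n f
    have h2 := gridInd_le_one m' b n f
    have h3 := gridInd_nonneg m a n f
    have h4 := gridInd_le_one m a n f
    exact abs_le.mpr ⟨by simp only [X]; linarith, by simp only [X]; linarith⟩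
  have hXi : ∀ n, Integrable (X n) (haarFracPi q d) := fun n =>
    integrable_of_abs_le (hXm n) (hX1 n)
  have hXe : ∀ n, ∫ f, X n f ∂haarFracPi q d = e := fun n => by
    simp only [X, e]
    rw [integral_sub (integrable_gridInd _ _ _) (integrable_gridInd _ _ _), integral_gridInd _ _ ha,
      integral_gridInd _ _ hb]
  have he : |e| ≤ 1 := by
    rw [← hXe 0]
    refine (abs_integral_le_integral_abs).trans ?_
    refine (integral_mono (hXi 0).abs (integrable_const 1) (hX1 0)).trans ?_
    simp
  have hX2 : ∀ n, ∫ f, (X n f - e) ^ 2 ∂haarFracPi q d ≤ v := by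
    intro n
    have hi2 : Integrable (fun f => X n f ^ 2) (haarFracPi q d) :=
      integrable_of_abs_le ((hXm n).pow_const 2) (b := 1) fun f => by
        rw [abs_pow]
        exact pow_le_one₀ (abs_nonneg _) (hX1 n f)
    have hexpand : ∫ f, (X n f - e) ^ 2 ∂haarFracPi q d =
        ∫ f, X n f ^ 2 ∂haarFracPi q d - e ^ 2 := by
      have h : ∀ f, (X n f - e) ^ 2 = X n f ^ 2 - (2 * e * X n f - e ^ 2) := fun f => by ring
      have hi3 : Integrable (fun f => 2 * e * X n f - e ^ 2) (haarFracPi q d) :=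
        ((hXi n).const_mul _).sub (integrable_const _)
      simp only [h]
      rw [integral_sub hi2 hi3,
        integral_sub ((hXi n).const_mul _) (integrable_const _), integral_const_mul, hXe n]
      simp only [integral_const, probReal_univ, smul_eq_mul]
      ring
    have hle : ∫ f, X n f ^ 2 ∂haarFracPi q d ≤ ∫ f, |X n f| ∂haarFracPi q d := by
      refine integral_mono hi2 (hXi n).abs fun f => ?_
      simp only
      rw [← sq_abs]
      nlinarith [abs_nonneg (X n f), hX1 n f]
    linarith [hv n, sq_nonneg e]
  have hdev : ∀ f, gridDev N m' b f - gridDev N m a f =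
      ∑ n ∈ Finset.range N, (X n f - e) := fun f => by
    rw [gridDev, gridDev, ← Finset.sum_sub_distrib]
    refine Finset.sum_congr rfl fun n _ => ?_
    simp only [X, e]
    ring
  simp only [hdev]
  refine measure_abs_sum_range_ge_le (g := fun n f => X n f - e) hm' (fun c => ?_)
    (fun n => (hXm n).sub_const e) (fun n f => ?_) (fun n => ?_) hX2 hs0 hs N τ
  · obtain ⟨F, hF⟩ := exists_gridInd_eq_comp_window (q := q) hmm a
    obtain ⟨G, hG⟩ := exists_gridInd_eq_comp_window (q := q) le_rfl b
    have h := (iIndepFun_windowPi (q := q) d c m' hm').comp (fun _ w => G w - F w - e)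
      fun _ => Measurable.of_discrete
    refine h.congr fun k => ae_of_all _ fun f => ?_
    simp only [Function.comp, X, hF, hG]
  · exact (abs_sub _ _).trans (by linarith [hX1 n f])
  · rw [integral_sub (hXi n) (integrable_const e), hXe n]
    simp

/-- The lower corner `l` and the upper corner `u`, on the grid of mesh `1 / Q`, enclose the box
`[0, t)`. The lower corner is strictly below `t`, unless it belongs to an empty box. -/
def GridBrackets (Q : ℕ) (t : Fin d → ℝ) (l u : Fin d → ℕ) : Prop :=
  ((∀ j, (l j : ℝ) < t j * Q) ∨ ∃ j, l j = 0) ∧ ∀ j, t j * Q ≤ u j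

/-- The indicator function of the event that the `n`-th point lies in `[0, t)`. -/
noncomputable def boxInd (t : Fin d → ℝ) (n : ℕ) (f : Fin d → FracSeries q) : ℝ :=
  open Classical in
  if (fun j => phi (fracPart (tVar q ^ n * (f j : LaurentSeries (ZMod q))))) ∈ box t then 1 else 0

/-- Strictness of the lower corner matters here: a point whose digits beyond the `m`-th are all
`q - 1` lies on the upper boundary of its grid cell. -/
theorem gridInd_le_boxInd {m : ℕ} {t : Fin d → ℝ} {l u : Fin d → ℕ}
    (h : GridBrackets (q ^ m) t l u) (n : ℕ) (f : Fin d → FracSeries q) :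
    gridInd m l n f ≤ boxInd t n f := by
  unfold gridInd boxInd
  split_ifs with h1 h2 <;> norm_num
  refine h2 fun j _ => ⟨?_, ?_⟩
  · exact le_trans (by positivity) (wordVal_le_phi (f j) n m).1
  · rcases h.1 with hl | ⟨i, hi⟩
    · have hQ : (0 : ℝ) < (q : ℝ) ^ m := by
        have := (Fact.out : q.Prime).pos
        positivity
      refine (wordVal_le_phi (f j) n m).2.trans_lt ?_
      rw [div_lt_iff₀ hQ]
      have h3 : ((wordVal (window q n m (f j)) : ℝ) + 1) ≤ l j := by
        exact_mod_cast h1 j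
      have h4 := hl j
      push_cast at h4
      linarith
    · have := h1 i
      omega

theorem boxInd_le_gridInd {m : ℕ} {t : Fin d → ℝ} {l u : Fin d → ℕ}
    (h : GridBrackets (q ^ m) t l u) (n : ℕ) (f : Fin d → FracSeries q) :
    boxInd t n f ≤ gridInd m u n f := by
  unfold gridInd boxInd
  split_ifs with h1 h2 <;> norm_num
  refine h2 fun j => ?_
  have hQ : (0 : ℝ) < (q : ℝ) ^ m := by
    have := (Fact.out : q.Prime).pos
    positivity
  have h3 := (wordVal_le_phi (f j) n m).1.trans_lt (h1 j trivial).2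
  rw [div_lt_iff₀ hQ] at h3
  have h4 := h.2 j
  push_cast at h4
  have h5 : (wordVal (window q n m (f j)) : ℝ) < u j := h3.trans_le h4
  exact_mod_cast h5

theorem gridVol_le_prod {m : ℕ} {t : Fin d → ℝ} (ht : ∀ j, 0 ≤ t j) {l u : Fin d → ℕ}
    (h : GridBrackets (q ^ m) t l u) : gridVol q m l ≤ ∏ j, t j := by
  have hQ : (0 : ℝ) < (q : ℝ) ^ m := by
    have := (Fact.out : q.Prime).pos
    positivity
  rcases h.1 with hl | ⟨i, hi⟩
  · refine Finset.prod_le_prod (fun j _ => by positivity) fun j _ => ?_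
    rw [div_le_iff₀ hQ]
    exact_mod_cast (hl j).le
  · rw [gridVol, Finset.prod_eq_zero (Finset.mem_univ i) (by simp [hi])]
    exact Finset.prod_nonneg fun j _ => ht j

theorem prod_le_gridVol {m : ℕ} {t : Fin d → ℝ} (ht : ∀ j, 0 ≤ t j) {l u : Fin d → ℕ}
    (h : GridBrackets (q ^ m) t l u) : ∏ j, t j ≤ gridVol q m u := by
  have hQ : (0 : ℝ) < (q : ℝ) ^ m := by
    have := (Fact.out : q.Prime).pos
    positivity
  refine Finset.prod_le_prod (fun j _ => ht j) fun j _ => ?_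
  rw [le_div_iff₀ hQ]
  exact_mod_cast h.2 j

/-- Corners of two brackets of the same box, of possibly different resolutions, belong to boxes
whose symmetric difference has at most the sum of the two bracket widths as measure. -/
theorem integral_abs_gridInd_sub_le {m m' : ℕ} {t : Fin d → ℝ} {l u l' u' a b : Fin d → ℕ}
    (h : GridBrackets (q ^ m) t l u) (h' : GridBrackets (q ^ m') t l' u')
    (hl : ∀ j, l j ≤ q ^ m) (hu : ∀ j, u j ≤ q ^ m) (hl' : ∀ j, l' j ≤ q ^ m')
    (hu' : ∀ j, u' j ≤ q ^ m') (ha : a = l ∨ a = u) (hb : b = l' ∨ b = u') (n : ℕ) :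
    ∫ f, |gridInd (q := q) m' b n f - gridInd m a n f| ∂haarFracPi q d ≤
      (gridVol q m u - gridVol q m l) + (gridVol q m' u' - gridVol q m' l') := by
  have hpt : ∀ f : Fin d → FracSeries q, |gridInd m' b n f - gridInd m a n f| ≤
      (gridInd m u n f - gridInd m l n f) + (gridInd m' u' n f - gridInd m' l' n f) := by
    intro f
    have h1 := gridInd_le_boxInd h n f
    have h2 := boxInd_le_gridInd h n f
    have h3 := gridInd_le_boxInd h' n f
    have h4 := boxInd_le_gridInd h' n f
    rcases ha with rfl | rfl <;> rcases hb with rfl | rfl <;>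
      exact abs_le.mpr ⟨by linarith, by linarith⟩
  have hi := fun (k : ℕ) (c : Fin d → ℕ) => integrable_gridInd (q := q) k c n
  have hi2 : ∀ (k : ℕ) (c c' : Fin d → ℕ),
      Integrable (fun f => gridInd (q := q) k c n f - gridInd k c' n f) (haarFracPi q d) :=
    fun k c c' => (hi k c).sub (hi k c')
  calc _ ≤ ∫ f, ((gridInd (q := q) m u n f - gridInd m l n f) +
        (gridInd m' u' n f - gridInd m' l' n f)) ∂haarFracPi q d :=
        integral_mono ((hi _ _).sub (hi _ _)).abs
          ((hi2 _ _ _).add (hi2 _ _ _)) hpt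
    _ = _ := by
        rw [integral_add (hi2 _ _ _) (hi2 _ _ _),
          integral_sub (hi _ _) (hi _ _), integral_sub (hi _ _) (hi _ _), integral_gridInd _ _ hl,
          integral_gridInd _ _ hu, integral_gridInd _ _ hl', integral_gridInd _ _ hu']

end GridBoxes

/-! ### The star discrepancy -/

section StarDiscrepancy

theorem volume_box {d : ℕ} (t : Fin d → ℝ) (ht : ∀ j, 0 ≤ t j) :
    (volume : Measure (Fin d → ℝ)).real (box t) = ∏ j, t j := by
  rw [box, measureReal_def, volume_pi_pi, ENNReal.toReal_prod]
  refine Finset.prod_congr rfl fun j _ => ?_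
  simp [ENNReal.toReal_ofReal (ht j)]

theorem ncard_eq_sum_boxInd {q d : ℕ} (N : ℕ) (f : Fin d → FracSeries q) (t : Fin d → ℝ) :
    (Set.ncard {n : Fin N | pointSet N f n ∈ box t} : ℝ) =
      ∑ n ∈ Finset.range N, boxInd t n f := by
  classical
  rw [Finset.sum_range, Set.ncard_eq_toFinset_card', Set.toFinset_ofPred, Finset.card_filter]
  push_cast
  rfl

theorem starDiscrepancy_le {d N : ℕ} (x : Fin N → Fin d → ℝ) {B : ℝ}
    (h : ∀ t : Fin d → ℝ, (∀ j, t j ∈ Set.Icc (0 : ℝ) 1) →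
      |(Set.ncard {n : Fin N | x n ∈ box t} : ℝ) / N - ∏ j, t j| ≤ B) :
    starDiscrepancy x ≤ B := by
  refine ciSup_le fun t => ?_
  rw [volume_box _ fun j => (t j).2.1]
  exact h (fun j => (t j : ℝ)) fun j => (t j).2

theorem starDiscrepancy_le_one {d N : ℕ} (x : Fin N → Fin d → ℝ) : starDiscrepancy x ≤ 1 := by
  refine starDiscrepancy_le x fun t ht => ?_
  have h1 : ∏ j, t j ≤ 1 := Finset.prod_le_one (fun j _ => (ht j).1) fun j _ => (ht j).2
  have h2 : 0 ≤ ∏ j, t j := Finset.prod_nonneg fun j _ => (ht j).1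
  have h3 : (Set.ncard {n : Fin N | x n ∈ box t} : ℝ) / N ≤ 1 := by
    refine div_le_one_of_le₀ ?_ (by positivity)
    have := Set.ncard_le_card {n : Fin N | x n ∈ box t}
    rw [Nat.card_fin] at this
    exact_mod_cast this
  have h4 : 0 ≤ (Set.ncard {n : Fin N | x n ∈ box t} : ℝ) / N := by positivity
  exact abs_le.mpr ⟨by linarith, by linarith⟩

end StarDiscrepancy

/-! ### Chaining -/

section Chaining

variable {q d : ℕ} [Fact q.Prime]

/-- Given covers `Γ h` of widths `3 / 4 ^ h`, the deviation of an arbitrary box is the sum of the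
increments along a chain of lower corners, which starts at the empty box and ends with the lower or
the upper corner of the finest bracket. -/
theorem abs_sum_boxInd_sub_le (hd : 0 < d) {m : ℕ → ℕ} {Γ : ℕ → Finset (Fin d → ℕ)}
    (hΓ0 : ∀ h, 0 ∈ Γ h) (hΓQ : ∀ h, ∀ a ∈ Γ h, ∀ j, a j ≤ q ^ m h)
    (hΓ : ∀ h, ∀ t : Fin d → ℝ, (∀ j, t j ∈ Set.Icc (0 : ℝ) 1) → ∃ l ∈ Γ h, ∃ u ∈ Γ h,
      GridBrackets (q ^ m h) t l u ∧ gridVol q (m h) u - gridVol q (m h) l ≤ 3 / 4 ^ h)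
    {N H : ℕ} {τ : ℕ → ℝ} {f : Fin d → FracSeries q}
    (hf : ∀ h < H + 1, ∀ a ∈ Γ h, ∀ b ∈ Γ (h + 1),
      (∀ n, ∫ f, |gridInd (q := q) (m (h + 1)) b n f - gridInd (m h) a n f| ∂haarFracPi q d ≤
        15 / 4 ^ (h + 1)) →
      |gridDev N (m (h + 1)) b f - gridDev N (m h) a f| ≤ τ h)
    (t : Fin d → ℝ) (ht : ∀ j, t j ∈ Set.Icc (0 : ℝ) 1) :
    |∑ n ∈ Finset.range N, boxInd t n f - N * ∏ j, t j| ≤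
      ∑ h ∈ Finset.range (H + 1), τ h + N * (3 / 4 ^ (H + 1)) := by
  choose l hl u hu hbr hgap using fun h => hΓ h t ht
  let a : ℕ → Fin d → ℕ := fun h => if h = 0 then 0 else l h
  have ha : ∀ h, a h ∈ Γ h := fun h => by
    by_cases h0 : h = 0 <;> simp [a, h0, hΓ0, hl]
  have hstep : ∀ h < H + 1, ∀ b, b = l (h + 1) ∨ b = u (h + 1) →
      |gridDev N (m (h + 1)) b f - gridDev N (m h) (a h) f| ≤ τ h := by
    intro h hh b hb
    have hbΓ : b ∈ Γ (h + 1) := by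
      rcases hb with rfl | rfl
      exacts [hl _, hu _]
    refine hf h hh (a h) (ha h) b hbΓ fun n => ?_
    rcases Nat.eq_zero_or_pos h with rfl | hpos
    · have hle : ∫ f, |gridInd (q := q) (m 1) b n f - gridInd (m 0) (a 0) n f| ∂haarFracPi q d ≤
          ∫ _f, (1 : ℝ) ∂haarFracPi q d := by
        refine integral_mono ((integrable_gridInd _ _ _).sub (integrable_gridInd _ _ _)).abs
          (integrable_const 1) fun f => ?_
        simp only [a, if_true, gridInd_zero hd, sub_zero]
        rw [abs_of_nonneg (gridInd_nonneg _ _ _ _)]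
        exact gridInd_le_one _ _ _ _
      refine hle.trans ?_
      norm_num
    · have hae : a h = l h := if_neg hpos.ne'
      refine (integral_abs_gridInd_sub_le (hbr h) (hbr (h + 1)) (hΓQ _ _ (hl h)) (hΓQ _ _ (hu h))
        (hΓQ _ _ (hl _)) (hΓQ _ _ (hu _)) (Or.inl hae) hb n).trans ?_
      have h1 := hgap h
      have h2 := hgap (h + 1)
      have h3 : (15 : ℝ) / 4 ^ (h + 1) = 3 / 4 ^ h + 3 / 4 ^ (h + 1) := by
        rw [pow_succ]
        field_simp
        norm_num
      linarith
  have hchain : ∀ h ≤ H, |gridDev N (m h) (a h) f| ≤ ∑ i ∈ Finset.range h, τ i := by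
    intro h
    induction h with
    | zero => simp [a, gridDev_zero hd]
    | succ h ih =>
      intro hh
      have h1 := ih (by omega)
      have h2 := hstep h (by omega) (a (h + 1)) (Or.inl (if_neg (Nat.succ_ne_zero h)))
      rw [Finset.sum_range_succ]
      have h3 := abs_le.mp h1
      have h4 := abs_le.mp h2
      exact abs_le.mpr ⟨by linarith, by linarith⟩
  have hlast : ∀ b, b = l (H + 1) ∨ b = u (H + 1) →
      |gridDev N (m (H + 1)) b f| ≤ ∑ i ∈ Finset.range (H + 1), τ i := by
    intro b hb
    have h1 := abs_le.mp (hchain H le_rfl)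
    have h2 := abs_le.mp (hstep H (by omega) b hb)
    rw [Finset.sum_range_succ]
    exact abs_le.mpr ⟨by linarith, by linarith⟩
  have hdev : ∀ b, gridDev N (m (H + 1)) b f =
      ∑ n ∈ Finset.range N, gridInd (m (H + 1)) b n f - N * gridVol q (m (H + 1)) b := by
    intro b
    simp [gridDev]
  have ht0 : ∀ j, 0 ≤ t j := fun j => (ht j).1
  have hlow := hlast _ (Or.inl rfl)
  have hupp := hlast _ (Or.inr rfl)
  rw [hdev] at hlow hupp
  have hlow := abs_le.mp hlow
  have hupp := abs_le.mp hupp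
  have h1 : ∑ n ∈ Finset.range N, gridInd (m (H + 1)) (l (H + 1)) n f ≤
      ∑ n ∈ Finset.range N, boxInd t n f :=
    Finset.sum_le_sum fun n _ => gridInd_le_boxInd (hbr (H + 1)) n f
  have h2 : ∑ n ∈ Finset.range N, boxInd t n f ≤
      ∑ n ∈ Finset.range N, gridInd (m (H + 1)) (u (H + 1)) n f :=
    Finset.sum_le_sum fun n _ => boxInd_le_gridInd (hbr (H + 1)) n f
  have h3 := gridVol_le_prod ht0 (hbr (H + 1))
  have h4 := prod_le_gridVol ht0 (hbr (H + 1))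
  have h5 := hgap (H + 1)
  have hN : (0 : ℝ) ≤ N := by positivity
  have h6 : (N : ℝ) * ∏ j, t j ≤ N * (gridVol q (m (H + 1)) (l (H + 1)) + 3 / 4 ^ (H + 1)) :=
    mul_le_mul_of_nonneg_left (by linarith) hN
  have h7 : (N : ℝ) * (gridVol q (m (H + 1)) (u (H + 1)) - 3 / 4 ^ (H + 1)) ≤ N * ∏ j, t j :=
    mul_le_mul_of_nonneg_left (by linarith) hN
  rw [mul_add] at h6
  rw [mul_sub] at h7
  exact abs_le.mpr ⟨by linarith [hlow.1], by linarith [hupp.2]⟩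

end Chaining

/-! ### The choice of parameters -/

section Parameters

theorem clog_two_le_log {d : ℕ} (hd : 2 ≤ d) : (Nat.clog 2 d : ℝ) ≤ 3 * Real.log d := by
  have hpos := Nat.clog_pos one_lt_two (by omega : 1 < d)
  have h1 : (2 : ℝ) ^ (Nat.clog 2 d - 1) ≤ d := by
    exact_mod_cast (Nat.pow_pred_clog_lt_self one_lt_two (by omega : 1 < d)).le
  have h2 := Real.log_le_log (by positivity) h1
  rw [Real.log_pow, Nat.cast_sub hpos] at h2
  have h3 : Real.log 2 ≤ Real.log d := Real.log_le_log (by norm_num) (by exact_mod_cast hd)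
  have h4 := Real.log_two_gt_d9
  have h5 : (Nat.clog 2 d : ℝ) * Real.log 2 ≤ 2 * Real.log d := by
    push_cast at h2
    linarith
  have h6 : (0 : ℝ) ≤ Nat.clog 2 d := by positivity
  nlinarith

/-- The number of digits used at level `h` of the chaining argument, so that `d * 4 ^ h` is at most
`q ^ m` for every `q ≥ 2`. -/
def resolution (d h : ℕ) : ℕ := Nat.clog 2 d + 2 * h

theorem mul_four_pow_le_pow_resolution {q : ℕ} (hq : 2 ≤ q) (d h : ℕ) :
    d * 4 ^ h ≤ q ^ resolution d h := by
  calc d * 4 ^ h ≤ 2 ^ Nat.clog 2 d * 4 ^ h :=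
        Nat.mul_le_mul_right _ (Nat.le_pow_clog one_lt_two d)
    _ = 2 ^ resolution d h := by
        rw [resolution, pow_add, pow_mul]
        norm_num
    _ ≤ q ^ resolution d h := Nat.pow_le_pow_left hq _

theorem resolution_le {d : ℕ} (hd : 2 ≤ d) (h : ℕ) :
    (resolution d (h + 1) : ℝ) ≤ 6 * (h + 1) * Real.log d := by
  have h1 := clog_two_le_log hd
  have h2 : Real.log 2 ≤ Real.log d := Real.log_le_log (by norm_num) (by exact_mod_cast hd)
  have h3 := Real.log_two_gt_d9
  have h4 : (0 : ℝ) ≤ h := by positivity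
  rw [resolution]
  push_cast
  nlinarith

/-- The choice `s = 2 ^ g A / 48` at level `g = h + 1`, where `A ^ 2 = d / (N log d)`, is admissible
in the exponential inequality and makes the variance term at most `g d`. -/
theorem exponent_bounds {h : ℕ} {m N d ℓ A : ℝ} (hm0 : 0 ≤ m) (hm : m ≤ 6 * (h + 1) * ℓ)
    (hA : 0 < A) (hℓ : 0 < ℓ) (hN : 0 < N) (hd : 1 ≤ d) (hAd : A ^ 2 * N * ℓ = d)
    (hr : 4 ^ h * (A * ℓ) ≤ 1) :
    2 * (2 ^ (h + 1) * A / 48) * m ≤ 1 ∧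
      (2 ^ (h + 1) * A / 48) ^ 2 * m * (N + m) * (15 / 4 ^ (h + 1)) ≤ (h + 1) * d := by
  have hg1 : ((h : ℝ) + 1) ≤ 2 ^ h := by
    exact_mod_cast (Nat.lt_two_pow_self : h < 2 ^ h)
  have h22 : (2 : ℝ) ^ h * 2 ^ h = 4 ^ h := by
    rw [← mul_pow]
    norm_num
  have h2pos : (1 : ℝ) ≤ 2 ^ h := one_le_pow₀ (by norm_num)
  have hAℓ : 0 < A * ℓ := by positivity
  constructor
  · calc 2 * (2 ^ (h + 1) * A / 48) * m ≤ 2 * (2 ^ (h + 1) * A / 48) * (6 * (h + 1) * ℓ) := by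
          gcongr
      _ = 2 ^ h * (h + 1) * (A * ℓ) / 2 := by ring
      _ ≤ 2 ^ h * 2 ^ h * (A * ℓ) / 2 := by gcongr
      _ ≤ 1 := by
          rw [h22]
          linarith
  · have hgA : ((h : ℝ) + 1) * (A * ℓ) ≤ 1 := by
      refine le_trans (mul_le_mul_of_nonneg_right ?_ hAℓ.le) hr
      nlinarith
    have hA1 : A * ℓ ≤ 1 := by
      have : (0 : ℝ) ≤ h := by positivity
      nlinarith
    have hgN : (h + 1) * ℓ ≤ N := by
      by_contra! hlt
      have h1 : A ^ 2 * N * ℓ < A ^ 2 * ((h + 1) * ℓ) * ℓ := by gcongr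
      have h2 : A ^ 2 * ((h + 1) * ℓ) * ℓ = ((h + 1) * (A * ℓ)) * (A * ℓ) := by ring
      have h3 : ((h + 1) * (A * ℓ)) * (A * ℓ) ≤ 1 := mul_le_one₀ hgA hAℓ.le hA1
      linarith
    have h44 : ((2 : ℝ) ^ (h + 1)) ^ 2 = 4 ^ (h + 1) := by
      rw [← pow_mul, mul_comm, pow_mul]
      norm_num
    calc (2 ^ (h + 1) * A / 48) ^ 2 * m * (N + m) * (15 / 4 ^ (h + 1))
        = A ^ 2 * m * (N + m) * (15 / 2304) := by
          rw [div_pow, mul_pow, h44]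
          field_simp
          ring
      _ ≤ A ^ 2 * (6 * (h + 1) * ℓ) * (N + 6 * N) * (15 / 2304) := by
          gcongr
          linarith
      _ = (630 / 2304) * ((h + 1) * (A ^ 2 * N * ℓ)) := by ring
      _ ≤ (h + 1) * d := by
          rw [hAd]
          have : 0 ≤ ((h : ℝ) + 1) * d := by positivity
          linarith

theorem sum_range_succ_div_two_pow_le (H : ℕ) :
    ∑ h ∈ Finset.range H, ((h : ℝ) + 1) / 2 ^ (h + 1) ≤ 2 := by
  have : ∑ h ∈ Finset.range H, ((h : ℝ) + 1) / 2 ^ (h + 1) = 2 - (H + 2) / 2 ^ H := by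
    induction H with
    | zero => norm_num
    | succ H ih =>
      rw [Finset.sum_range_succ, ih, pow_succ]
      push_cast
      field_simp
      ring
  rw [this]
  have : (0 : ℝ) ≤ ((H : ℝ) + 2) / 2 ^ H := by positivity
  linarith

theorem sum_range_inv_two_pow_le (H : ℕ) : ∑ h ∈ Finset.range H, (1 : ℝ) / 2 ^ (h + 1) ≤ 1 := by
  have : ∑ h ∈ Finset.range H, (1 : ℝ) / 2 ^ (h + 1) = 1 - 1 / 2 ^ H := by
    induction H with
    | zero => norm_num
    | succ H ih =>
      rw [Finset.sum_range_succ, ih, pow_succ]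
      field_simp
      ring
  rw [this]
  have : (0 : ℝ) ≤ 1 / 2 ^ H := by positivity
  linarith

/-- The pairs of boxes of two consecutive levels number at most `exp (9 g d)`, `g = h + 1`; against
the tail `exp (g d - g d (12 + L))` their total contribution is at most `exp (-L) / 2 ^ g`. -/
theorem card_mul_tail_le {h d : ℕ} (hd : 2 ≤ d) {L : ℝ} (hL : 0 < L) {x y : ℝ}
    (hy0 : 0 ≤ y) (hx : x ≤ Real.exp (d * (3 + 3 * h)))
    (hy : y ≤ Real.exp (d * (3 + 3 * (h + 1)))) :
    x * y * (2 * Real.exp ((h + 1) * d - (h + 1) * d * (12 + L))) ≤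
      Real.exp (-L) * (1 / 2 ^ (h + 1)) := by
  have hd' : (2 : ℝ) ≤ d := by exact_mod_cast hd
  have hh : (0 : ℝ) ≤ h := by positivity
  have h2e : (2 : ℝ) ≤ Real.exp 1 := by linarith [Real.exp_one_gt_d9]
  have hpow : (2 : ℝ) ^ (h + 1) ≤ Real.exp (h + 1) := by
    have : Real.exp ((h : ℝ) + 1) = Real.exp 1 ^ (h + 1) := by
      rw [← Real.exp_nat_mul]
      push_cast
      ring_nf
    rw [this]
    gcongr
  have hexp : 1 + (d * (3 + 3 * (h : ℝ)) + d * (3 + 3 * (h + 1)) +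
      ((h + 1) * d - (h + 1) * d * (12 + L))) ≤ -L + -(h + 1) := by
    have h1 : 2 ≤ ((h : ℝ) + 1) * d := by nlinarith
    have h2 : L ≤ ((h : ℝ) + 1) * d * L := by nlinarith
    nlinarith
  calc x * y * (2 * Real.exp ((h + 1) * d - (h + 1) * d * (12 + L)))
      ≤ Real.exp (d * (3 + 3 * h)) * Real.exp (d * (3 + 3 * (h + 1))) *
        (Real.exp 1 * Real.exp ((h + 1) * d - (h + 1) * d * (12 + L))) := by gcongr
    _ = Real.exp (1 + (d * (3 + 3 * (h : ℝ)) + d * (3 + 3 * (h + 1)) +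
        ((h + 1) * d - (h + 1) * d * (12 + L)))) := by
        rw [← Real.exp_add, ← Real.exp_add, ← Real.exp_add]
        congr 1
        ring
    _ ≤ Real.exp (-L + -(h + 1)) := Real.exp_le_exp.mpr hexp
    _ = Real.exp (-L) * (1 / Real.exp (h + 1)) := by
        rw [Real.exp_add, Real.exp_neg ((h : ℝ) + 1), one_div]
    _ ≤ Real.exp (-L) * (1 / 2 ^ (h + 1)) := by gcongr

end Parameters

/-! ### The discrepancy bound -/

/-- The exceptional set has measure at most `exp (-L)`. In the constant, `96 (12 + L)` is the sum of
the increments of the chain and the remaining `3` is the width of the finest bracket. -/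
theorem measure_lt_starDiscrepancy_le (q : ℕ) [Fact q.Prime] {N d : ℕ} (hN : 0 < N) (hd : 2 ≤ d)
    {L : ℝ} (hL : 0 < L) (hr : Real.sqrt ((d : ℝ) * Real.log d / N) ≤ 1) :
    (haarFracPi q d).real {f | (1155 + 96 * L) * Real.sqrt ((d : ℝ) * Real.log d / N) <
      starDiscrepancy (pointSet N f)} ≤ Real.exp (-L) := by
  classical
  have hq : 2 ≤ q := (Fact.out : q.Prime).two_le
  have hN' : (0 : ℝ) < N := by exact_mod_cast hN
  have hd' : (2 : ℝ) ≤ d := by exact_mod_cast hd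
  set ℓ : ℝ := Real.log d
  have hℓ : 0 < ℓ := Real.log_pos (by linarith)
  set A : ℝ := Real.sqrt (d / (N * ℓ)) with hA_def
  have hA : 0 < A := Real.sqrt_pos.mpr (by positivity)
  have hAd : A ^ 2 * N * ℓ = d := by
    rw [hA_def, Real.sq_sqrt (by positivity)]
    field_simp
  have hrA : Real.sqrt ((d : ℝ) * ℓ / N) = A * ℓ := by
    rw [hA_def, show (d : ℝ) * ℓ / N = d / (N * ℓ) * ℓ ^ 2 by field_simp,
      Real.sqrt_mul (by positivity), Real.sqrt_sq hℓ.le]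
  rw [hrA] at hr ⊢
  have hAℓ : 0 < A * ℓ := by positivity
  -- The finest level is the one whose bracket width `4⁻⁽ᴴ⁺¹⁾` is comparable to the bound.
  obtain ⟨H, hH1, hH2⟩ := exists_nat_pow_near_of_lt_one hAℓ hr (y := (1 / 4 : ℝ)) (by norm_num)
    (by norm_num)
  have hcover := fun h => exists_bracketing_cover d h (q ^ resolution d h) (by omega)
    (mul_four_pow_le_pow_resolution hq d h)
  choose Γ hΓ0 hΓQ hΓcard hΓ using hcover
  set m := resolution d
  have hΓ' : ∀ h, ∀ t : Fin d → ℝ, (∀ j, t j ∈ Set.Icc (0 : ℝ) 1) → ∃ l ∈ Γ h, ∃ u ∈ Γ h,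
      GridBrackets (q ^ m h) t l u ∧ gridVol q (m h) u - gridVol q (m h) l ≤ 3 / 4 ^ h := by
    intro h t ht
    obtain ⟨l, hl, u, hu, h1, h2, h3⟩ := hΓ h t ht
    refine ⟨l, hl, u, hu, ⟨h1, h2⟩, ?_⟩
    simpa [gridVol] using h3
  let s : ℕ → ℝ := fun h => 2 ^ (h + 1) * A / 48
  let τ : ℕ → ℝ := fun h => 48 * (12 + L) * (A * N * ℓ) * (((h : ℝ) + 1) / 2 ^ (h + 1))
  have hsτ : ∀ h, s h * τ h = (h + 1) * d * (12 + L) := by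
    intro h
    rw [← hAd]
    simp only [s, τ]
    field_simp
  let pairs : ℕ → Finset ((Fin d → ℕ) × (Fin d → ℕ)) := fun h =>
    (Γ h ×ˢ Γ (h + 1)).filter fun p => ∀ n,
      ∫ f, |gridInd (q := q) (m (h + 1)) p.2 n f - gridInd (m h) p.1 n f| ∂haarFracPi q d ≤
        15 / 4 ^ (h + 1)
  let bad : Set (Fin d → FracSeries q) := ⋃ h ∈ Finset.range (H + 1), ⋃ p ∈ pairs h,
    {f | τ h ≤ |gridDev N (m (h + 1)) p.2 f - gridDev N (m h) p.1 f|}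
  have hlevel : ∀ h ∈ Finset.range (H + 1), (haarFracPi q d).real (⋃ p ∈ pairs h,
      {f | τ h ≤ |gridDev N (m (h + 1)) p.2 f - gridDev N (m h) p.1 f|}) ≤
      Real.exp (-L) * (1 / 2 ^ (h + 1)) := by
    intro h hh
    have hr' : 4 ^ h * (A * ℓ) ≤ 1 := by
      have h1 : (4 : ℝ) ^ h ≤ 4 ^ H :=
        pow_le_pow_right₀ (by norm_num) (Nat.lt_succ_iff.mp (Finset.mem_range.mp hh))
      calc 4 ^ h * (A * ℓ) ≤ 4 ^ H * (1 / 4) ^ H := by gcongr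
        _ = 1 := by
          rw [← mul_pow]
          norm_num
    obtain ⟨hs1, hs2⟩ := exponent_bounds (h := h) (m := m (h + 1)) (N := N) (d := d)
      (by positivity) (resolution_le hd h) hA hℓ hN' (by linarith) hAd hr'
    have hpair : ∀ p ∈ pairs h, (haarFracPi q d).real
        {f | τ h ≤ |gridDev N (m (h + 1)) p.2 f - gridDev N (m h) p.1 f|} ≤
        2 * Real.exp ((h + 1) * d - (h + 1) * d * (12 + L)) := by
      intro p hp
      obtain ⟨hpΓ, hpv⟩ := Finset.mem_filter.mp hp
      obtain ⟨hp1, hp2⟩ := Finset.mem_product.mp hpΓ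
      refine (measure_gridDev_sub_ge_le (m := m h) (m' := m (h + 1)) (by simp [m, resolution])
        (by simp [m, resolution]) (hΓQ _ _ hp1) (hΓQ _ _ hp2) hpv (s := s h) (by positivity) hs1
        N (τ h)).trans ?_
      rw [hsτ]
      gcongr
    calc (haarFracPi q d).real (⋃ p ∈ pairs h,
          {f | τ h ≤ |gridDev N (m (h + 1)) p.2 f - gridDev N (m h) p.1 f|})
        ≤ ∑ p ∈ pairs h, 2 * Real.exp ((h + 1) * d - (h + 1) * d * (12 + L)) :=
          (measureReal_biUnion_finset_le _ _).trans (Finset.sum_le_sum hpair)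
      _ ≤ (Γ h).card * (Γ (h + 1)).card *
          (2 * Real.exp ((h + 1) * d - (h + 1) * d * (12 + L))) := by
          rw [Finset.sum_const, nsmul_eq_mul]
          gcongr
          have : (pairs h).card ≤ (Γ h).card * (Γ (h + 1)).card :=
            (Finset.card_filter_le _ _).trans_eq (Finset.card_product _ _)
          exact_mod_cast this
      _ ≤ Real.exp (-L) * (1 / 2 ^ (h + 1)) :=
          card_mul_tail_le hd hL (by positivity) (hΓcard h) (by exact_mod_cast hΓcard (h + 1))
  have hbad : (haarFracPi q d).real bad ≤ Real.exp (-L) := by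
    refine (measureReal_biUnion_finset_le _ _).trans ((Finset.sum_le_sum hlevel).trans ?_)
    rw [← Finset.mul_sum]
    exact mul_le_of_le_one_right (Real.exp_pos _).le (sum_range_inv_two_pow_le _)
  refine (measureReal_mono (fun f hf => ?_) (measure_ne_top _ _)).trans hbad
  by_contra hfbad
  refine (not_le.mpr (show _ < _ from hf)) (starDiscrepancy_le _ fun t ht => ?_)
  have hincr : ∀ h < H + 1, ∀ a ∈ Γ h, ∀ b ∈ Γ (h + 1),
      (∀ n, ∫ f, |gridInd (q := q) (m (h + 1)) b n f - gridInd (m h) a n f| ∂haarFracPi q d ≤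
        15 / 4 ^ (h + 1)) →
      |gridDev N (m (h + 1)) b f - gridDev N (m h) a f| ≤ τ h := by
    intro h hh a ha b hb hab
    by_contra! hlt
    refine hfbad (Set.mem_biUnion (Finset.mem_range.mpr hh) (Set.mem_biUnion (x := (a, b)) ?_ hlt.le))
    exact Finset.mem_filter.mpr ⟨Finset.mem_product.mpr ⟨ha, hb⟩, hab⟩
  have hchain := abs_sum_boxInd_sub_le (by omega) hΓ0 hΓQ hΓ' hincr t ht
  rw [ncard_eq_sum_boxInd]
  have hτ : ∑ h ∈ Finset.range (H + 1), τ h ≤ 48 * (12 + L) * (A * N * ℓ) * 2 := by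
    simp only [τ]
    rw [← Finset.mul_sum]
    exact mul_le_mul_of_nonneg_left (sum_range_succ_div_two_pow_le _) (by positivity)
  have hfine : (3 : ℝ) / 4 ^ (H + 1) ≤ 3 * (A * ℓ) := by
    have : (3 : ℝ) / 4 ^ (H + 1) = 3 * (1 / 4) ^ (H + 1) := by
      rw [one_div, inv_pow, div_eq_mul_inv]
    rw [this]
    linarith
  have hfineN := mul_le_mul_of_nonneg_left hfine hN'.le
  have hdiv : (∑ n ∈ Finset.range N, boxInd t n f) / N - ∏ j, t j =
      (∑ n ∈ Finset.range N, boxInd t n f - N * ∏ j, t j) / N := by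
    field_simp
  rw [hdiv, abs_div, abs_of_pos hN', div_le_iff₀ hN']
  nlinarith

/-- The bound of the theorem with an explicit constant. It is trivial as soon as
`√(d log d / N) ≥ 1`, since a discrepancy never exceeds `1`. -/
theorem ofReal_one_sub_le_measure_starDiscrepancy_le (q : ℕ) [Fact q.Prime] {N d : ℕ} (hN : 0 < N)
    (hd : 2 ≤ d) {ε : ℝ} (hε : ε ∈ Set.Ioo (0 : ℝ) 1) :
    ENNReal.ofReal (1 - ε) ≤ haarFracPi q d {f : Fin d → FracSeries q |
      starDiscrepancy (pointSet N f) ≤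
        (1155 + 96 * Real.log (1 / ε)) * Real.sqrt ((d : ℝ) * Real.log d / N)} := by
  have hL : 0 < Real.log (1 / ε) := Real.log_pos ((one_lt_div hε.1).mpr hε.2)
  set G := {f : Fin d → FracSeries q | starDiscrepancy (pointSet N f) ≤
    (1155 + 96 * Real.log (1 / ε)) * Real.sqrt ((d : ℝ) * Real.log d / N)} with hG
  rcases le_total (Real.sqrt ((d : ℝ) * Real.log d / N)) 1 with hr | hr
  · have h := measure_lt_starDiscrepancy_le q hN hd hL hr
    rw [Real.log_div one_ne_zero hε.1.ne', Real.log_one, zero_sub, neg_neg, Real.exp_log hε.1] at h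
    have hcompl : Gᶜ = {f | (1155 + 96 * -Real.log ε) * Real.sqrt ((d : ℝ) * Real.log d / N) <
        starDiscrepancy (pointSet N f)} := by
      ext f
      simp [hG]
    rw [← hcompl] at h
    -- No measurability is needed: subadditivity bounds the measure of the set from below.
    have hone : 1 ≤ (haarFracPi q d).real G + (haarFracPi q d).real Gᶜ := by
      rw [← probReal_univ (μ := haarFracPi q d), ← Set.union_compl_self G]
      exact measureReal_union_le _ _
    rw [← ofReal_measureReal]
    exact ENNReal.ofReal_le_ofReal (by linarith)
  · have huniv : G = Set.univ := by
      refine Set.eq_univ_of_forall fun f => (starDiscrepancy_le_one _).trans ?_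
      nlinarith
    rw [huniv, measure_univ]
    exact ENNReal.ofReal_le_one.mpr (by linarith [hε.1])

theorem isTheta_add_mul_log {a b : ℝ} (ha : 0 ≤ a) (hb : 0 < b) :
    (fun ε => a + b * Real.log (1 / ε)) =Θ[𝓝[>] (0 : ℝ)] fun ε => Real.log (1 / ε) := by
  have hev : ∀ᶠ ε in 𝓝[>] (0 : ℝ), 1 ≤ Real.log (1 / ε) := by
    filter_upwards [Ioo_mem_nhdsGT (Real.exp_pos (-1))] with ε hε
    rw [one_div, Real.log_inv]
    have := Real.log_lt_log hε.1 hε.2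
    rw [Real.log_exp] at this
    linarith
  constructor
  · refine IsBigO.of_bound (a + b) ?_
    filter_upwards [hev] with ε hε
    rw [Real.norm_of_nonneg (by positivity), Real.norm_of_nonneg (by positivity)]
    nlinarith
  · refine IsBigO.of_bound b⁻¹ ?_
    filter_upwards [hev] with ε hε
    rw [Real.norm_of_nonneg (by positivity), Real.norm_of_nonneg (by positivity), mul_add,
      inv_mul_cancel_left₀ hb.ne']
    have : 0 ≤ b⁻¹ * a := by positivity
    linarith

theorem theorem2 (q : ℕ) [Fact q.Prime] :
    ∃ C : ℝ → ℝ,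
      (∀ ε ∈ Set.Ioo (0 : ℝ) 1, 0 < C ε) ∧
      C =Θ[𝓝[>] (0 : ℝ)] (fun ε => Real.log (1 / ε)) ∧
      ∀ N d : ℕ, 2 ≤ N → 2 ≤ d → ∀ ε ∈ Set.Ioo (0 : ℝ) 1,
        ENNReal.ofReal (1 - ε) ≤
          haarFracPi q d {f : Fin d → FracSeries q |
            starDiscrepancy (pointSet N f) ≤
              C ε * Real.sqrt ((d : ℝ) * Real.log d / (N : ℝ))} := by
  refine ⟨fun ε => 1155 + 96 * Real.log (1 / ε), fun ε hε => ?_,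
    isTheta_add_mul_log (by norm_num) (by norm_num), fun N d hN hd ε hε =>
      ofReal_one_sub_le_measure_starDiscrepancy_le q (by omega) hd hε⟩
  have : 0 < Real.log (1 / ε) := Real.log_pos ((one_lt_div hε.1).mpr hε.2)
  positivity
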